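/- Let $p$ be an odd prime and let $\alpha\in\mathbb Z_p^\times=\{x\in\mathbb Z_p: p\nmid x\}$. For $x\in\mathbb Z_p$ let $\langle x\rangle_p\in\{0,1,\dots,p-1\}$ denote the least nonnegative residue of $x$ modulo $p$, put $\alpha_p^*=(\alpha+\langle-\alpha\rangle_p)/p\in\mathbb Z_p$, and let $${}_3F_2\bigg[\begin{matrix}\alpha&\alpha&\alpha\\&1&1\end{matrix}\bigg|\,1\bigg]_{p-1}=\sum_{k=0}^{p-1}\frac{(\alpha)_k^3}{(1)_k^2\,k!},\qquad (x)_k=x(x+1)\cdots(x+k-1).$$ Let $\Gamma_p:\mathbb Z_p\to\mathbb Z_p^\times$ be Morita's $p$-adic Gamma function, i.e. the continuous function with $\Gamma_p(0)=1$ and $\Gamma_p(n)=(-1)^n\prod_{1\le k<n,\ p\nmid k}k$ for all integers $n\ge1$, and let $$g_p(\alpha)=\frac{\Gamma_p(1+\frac12\alpha)\,\Gamma_p(1-\frac32\alpha)}{\Gamma_p(1+\alpha)\,\Gamma_p(1-\alpha)\,\Gamma_p(1-\frac12\alpha)^2}.$$ Then, modulo $p^3$, $${}_3F_2\bigg[\begin{matrix}\alpha&\alpha&\alpha\\&1&1\end{matrix}\bigg|\,1\bigg]_{p-1}\equiv\begin{cases}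 2g_p(\alpha)&\text{if }\langle-\alpha\rangle_p\text{ is even and }\langle-\alpha\rangle_p<\frac23p,\\ p(2-3\alpha_p^*)\,g_p(\alpha)&\text{if }\langle-\alpha\rangle_p\text{ is even and }\langle-\alpha\rangle_p\ge\frac23p,\\ p\,\alpha_p^*\,g_p(\alpha)&\text{if }\langle-\alpha\rangle_p\text{ is odd and }\langle-\alpha\rangle_p<\frac13p,\\ \frac12p^2\alpha_p^*(1-3\alpha_p^*)\,g_p(\alpha)&\text{if }\langle-\alpha\rangle_p\text{ is odd and }\langle-\alpha\rangle_p\ge\frac13p. \end{cases}$$ -/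

import Mathlib

open Filter Topology

noncomputable section

/-- The truncated hypergeometric series
`∑_{k=0}^{n} ((a₀)_k ⋯ (a_r)_k) / ((b₁)_k ⋯ (b_s)_k) * z^k / k!`
with upper parameters `a`, lower parameters `b` and argument `z`, where
`(x)_k = x (x+1) ⋯ (x+k-1)`. -/
def truncHypergeom {K : Type*} [Field K] (a b : List K) (z : K) (n : ℕ) : K :=
  ∑ k ∈ Finset.range (n + 1),
    (a.map fun x => (ascPochhammer K k).eval x).prod /
      (b.map fun x => (ascPochhammer K k).eval x).prod * (z ^ k / (k.factorial : K))

/-- Morita's `p`-adic Gamma function on the natural numbers: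
`(-1)^n` times the product of all `1 ≤ k < n` prime to `p` (so the value at `0` is `1`). -/
def padicGammaNat (p : ℕ) [Fact p.Prime] (n : ℕ) : ℤ_[p] :=
  (-1) ^ n * ∏ k ∈ (Finset.Ico 1 n).filter (fun k => ¬ p ∣ k), (k : ℤ_[p])

/-- Morita's `p`-adic Gamma function on `ℤ_p` for odd `p`: the limit of its values at natural
numbers `n` as `n` tends `p`-adically to `x`. -/
def padicGamma (p : ℕ) [Fact p.Prime] (x : ℤ_[p]) : ℤ_[p] :=
  limUnder (comap (fun n : ℕ => (n : ℤ_[p])) (𝓝 x)) (padicGammaNat p)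

/-- The least nonnegative residue of the `p`-adic integer `x` modulo `p`. -/
def leastResidue (p : ℕ) [Fact p.Prime] (x : ℤ_[p]) : ℕ :=
  (PadicInt.toZMod x).val

/-- The dash operation `(α + ⟨-α⟩_p) / p`. -/
def padicDash (p : ℕ) [Fact p.Prime] (α : ℤ_[p]) : ℚ_[p] :=
  ((α : ℚ_[p]) + (leastResidue p (-α) : ℚ_[p])) / (p : ℚ_[p])

/-- The element `1/2` of `ℤ_p`, for odd `p`. -/
def padicHalf (p : ℕ) [Fact p.Prime] : ℤ_[p] := PadicInt.inv 2

/-- `Γ_p(1+α/2) Γ_p(1-3α/2) / (Γ_p(1+α) Γ_p(1-α) Γ_p(1-α/2)^2)`. -/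
def dixonG (p : ℕ) [Fact p.Prime] (α : ℤ_[p]) : ℚ_[p] :=
  ((padicGamma p (1 + padicHalf p * α) : ℚ_[p]) *
      (padicGamma p (1 - 3 * padicHalf p * α) : ℚ_[p])) /
    ((padicGamma p (1 + α) : ℚ_[p]) * (padicGamma p (1 - α) : ℚ_[p]) *
      (padicGamma p (1 - padicHalf p * α) : ℚ_[p]) ^ 2)

/-- Congruence modulo `p ^ r`: the difference lies in `p ^ r ℤ_p`. -/
def PadicCongr (p : ℕ) [Fact p.Prime] (r : ℕ) (x y : ℚ_[p]) : Prop :=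
  ∃ c : ℤ_[p], x - y = (p : ℚ_[p]) ^ r * (c : ℚ_[p])

end

theorem ZMod.sq_eq_one_of_prime_pow {p : ℕ} [Fact p.Prime] (hp : Odd p) {N : ℕ}
    (x : ZMod (p ^ N)) (hx : x ^ 2 = 1) : x = 1 ∨ x = -1 := by
  obtain ⟨k, rfl⟩ := ZMod.intCast_surjective x
  have hpp : Prime (p : ℤ) := Nat.prime_iff_prime_int.mp Fact.out
  have h : ((p : ℤ) ^ N) ∣ (k - 1) * (k + 1) := by
    have : (((k - 1) * (k + 1) : ℤ) : ZMod (p ^ N)) = 0 := by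
      push_cast
      linear_combination hx
    have := (ZMod.intCast_zmod_eq_zero_iff_dvd _ _).mp this
    exact_mod_cast this
  have key : ∀ y : ℤ, (p : ℤ) ^ N ∣ y → (y : ZMod (p ^ N)) = 0 := fun y hy =>
    (ZMod.intCast_zmod_eq_zero_iff_dvd _ _).mpr (by exact_mod_cast hy)
  by_cases h1 : (p : ℤ) ∣ k - 1
  · by_cases h2 : (p : ℤ) ∣ k + 1
    · exfalso
      have h3 : (p : ℤ) ∣ 2 := by
        have := dvd_sub h2 h1
        ring_nf at this
        exact this
      have h4 : p ∣ 2 := by exact_mod_cast h3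
      have := (Nat.prime_dvd_prime_iff_eq Fact.out Nat.prime_two).mp h4
      subst this
      exact absurd hp (by decide)
    · left
      have := key _ (hpp.pow_dvd_of_dvd_mul_right N h2 h)
      push_cast at this
      exact sub_eq_zero.mp this
  · right
    have := key _ (hpp.pow_dvd_of_dvd_mul_left N h1 h)
    push_cast at this
    exact eq_neg_of_add_eq_zero_left this

theorem ZMod.prod_units_prime_pow {p : ℕ} [Fact p.Prime] (hp : Odd p) {N : ℕ} (hN : N ≠ 0) :
    ∏ u : (ZMod (p ^ N))ˣ, u = -1 := by
  have hne : (1 : (ZMod (p ^ N))ˣ) ≠ -1 := by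
    intro h
    have h2 : ((2 : ℕ) : ZMod (p ^ N)) = 0 := by
      have := congrArg Units.val h
      push_cast at this ⊢
      linear_combination this
    rw [ZMod.natCast_eq_zero_iff] at h2
    have h4 : p ∣ 2 := (dvd_pow_self p hN).trans h2
    have := (Nat.prime_dvd_prime_iff_eq Fact.out Nat.prime_two).mp h4
    subst this
    exact absurd hp (by decide)
  rw [← Finset.mul_prod_erase Finset.univ _ (Finset.mem_univ (-1 : (ZMod (p ^ N))ˣ))]
  rw [Finset.prod_involution (fun x _ => x⁻¹), mul_one]
  · simp
  · intro x hx hx1 hinv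
    have hsq : (x : ZMod (p ^ N)) ^ 2 = 1 := by
      have : x ^ 2 = 1 := by rw [pow_two]; nth_rewrite 1 [← hinv]; simp
      rw [← Units.val_pow_eq_pow_val, this, Units.val_one]
    rcases ZMod.sq_eq_one_of_prime_pow hp _ hsq with h | h
    · exact hx1 (Units.ext h)
    · exact (Finset.ne_of_mem_erase hx) (Units.ext (by simpa using h))
  · intro x hx
    simp only [Finset.mem_erase, Finset.mem_univ, and_true] at hx ⊢
    intro h
    apply hx
    rw [← inv_inv x, h]
    simp
  · intro x hx
    simp

@[to_additive]
theorem ZMod.prod_univ_eq_prod_range {M : Type*} [CommMonoid M] (N : ℕ) [NeZero N]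
    (f : ZMod N → M) : ∏ x : ZMod N, f x = ∏ k ∈ Finset.range N, f k := by
  symm
  refine Finset.prod_bij (fun k _ => (k : ZMod N)) (fun _ _ => Finset.mem_univ _) ?_ ?_
    (fun _ _ => rfl)
  · intro a ha b hb h
    rw [Finset.mem_range] at ha hb
    have := (ZMod.natCast_eq_natCast_iff' a b N).mp h
    rwa [Nat.mod_eq_of_lt ha, Nat.mod_eq_of_lt hb] at this
  · intro x _
    exact ⟨x.val, Finset.mem_range.mpr (ZMod.val_lt x), by simp⟩

theorem ZMod.prod_Ico_eq_prod_univ {M : Type*} [CommMonoid M] (N : ℕ) [NeZero N]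
    (f : ZMod N → M) (n : ℕ) : ∏ k ∈ Finset.Ico n (n + N), f k = ∏ x : ZMod N, f x := by
  have hN : 0 < N := Nat.pos_of_ne_zero (NeZero.ne N)
  induction n with
  | zero => rw [ZMod.prod_univ_eq_prod_range, zero_add, Finset.range_eq_Ico]
  | succ n ih =>
    rw [← ih, Finset.prod_eq_prod_Ico_succ_bot (by omega : n < n + N),
      show n + 1 + N = n + N + 1 by ring, Finset.prod_Ico_succ_top (by omega)]
    simp [mul_comm]

/-- The factor by which `-Γ_p` changes from `x` to `x + 1`: `x` if `x` is a unit, else `1`. -/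
noncomputable def unitPart (p : ℕ) [Fact p.Prime] (x : ℤ_[p]) : ℤ_[p] :=
  open Classical in if (p : ℤ_[p]) ∣ x then 1 else x

section
variable {p : ℕ} [Fact p.Prime]

theorem unitPart_of_dvd {x : ℤ_[p]} (h : (p : ℤ_[p]) ∣ x) : unitPart p x = 1 := if_pos h

theorem unitPart_of_not_dvd {x : ℤ_[p]} (h : ¬ (p : ℤ_[p]) ∣ x) : unitPart p x = x := if_neg h

theorem PadicInt.isUnit_iff_not_dvd {x : ℤ_[p]} : IsUnit x ↔ ¬ (p : ℤ_[p]) ∣ x := by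
  rw [PadicInt.isUnit_iff, ← PadicInt.norm_lt_one_iff_dvd]
  constructor
  · intro h; rw [h]; exact lt_irrefl _
  · intro h; exact le_antisymm (PadicInt.norm_le_one x) (not_lt.mp h)

theorem isUnit_unitPart (x : ℤ_[p]) : IsUnit (unitPart p x) := by
  by_cases h : (p : ℤ_[p]) ∣ x
  · rw [unitPart_of_dvd h]; exact isUnit_one
  · rw [unitPart_of_not_dvd h]; exact PadicInt.isUnit_iff_not_dvd.mpr h

theorem PadicInt.natCast_dvd_natCast (k : ℕ) : (p : ℤ_[p]) ∣ (k : ℤ_[p]) ↔ p ∣ k := by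
  have := PadicInt.pow_p_dvd_int_iff (p := p) 1 (k : ℤ)
  simp only [pow_one, Int.cast_natCast] at this
  rw [this]
  exact Int.natCast_dvd_natCast

theorem padicGammaNat_eq_prod (n : ℕ) :
    padicGammaNat p n = ∏ k ∈ Finset.range n, -unitPart p (k : ℤ_[p]) := by
  rw [Finset.prod_neg, Finset.card_range, padicGammaNat]
  congr 1
  rw [Finset.prod_filter]
  rcases Nat.eq_zero_or_pos n with rfl | hn
  · simp
  rw [Finset.range_eq_Ico, Finset.prod_eq_prod_Ico_succ_bot hn]
  rw [Nat.cast_zero, unitPart_of_dvd (dvd_zero _), one_mul]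
  refine Finset.prod_congr rfl fun k _ => ?_
  by_cases h : p ∣ k
  · rw [unitPart_of_dvd ((PadicInt.natCast_dvd_natCast k).mpr h)]; simp [h]
  · rw [unitPart_of_not_dvd (fun h' => h ((PadicInt.natCast_dvd_natCast k).mp h'))]; simp [h]

theorem padicGammaNat_succ (n : ℕ) :
    padicGammaNat p (n + 1) = -unitPart p (n : ℤ_[p]) * padicGammaNat p n := by
  rw [padicGammaNat_eq_prod, padicGammaNat_eq_prod, Finset.prod_range_succ, mul_comm]

theorem toZModPow_unitPart {N : ℕ} (hN : N ≠ 0) (k : ℕ) :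
    PadicInt.toZModPow N (unitPart p (k : ℤ_[p])) =
      (open Classical in if IsUnit (k : ZMod (p ^ N)) then (k : ZMod (p ^ N)) else 1) := by
  have : IsUnit (k : ZMod (p ^ N)) ↔ ¬ p ∣ k := by
    rw [ZMod.isUnit_iff_coprime, Nat.coprime_pow_right_iff (Nat.pos_of_ne_zero hN),
      Nat.coprime_comm, Nat.Prime.coprime_iff_not_dvd Fact.out]
  by_cases h : p ∣ k
  · rw [unitPart_of_dvd ((PadicInt.natCast_dvd_natCast k).mpr h), if_neg (by simp [this, h])]
    simp
  · rw [unitPart_of_not_dvd (fun h' => h ((PadicInt.natCast_dvd_natCast k).mp h')),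
      if_pos (this.mpr h)]
    simp

theorem toZModPow_padicGammaNat_add (hp : Odd p) (N n : ℕ) :
    PadicInt.toZModPow N (padicGammaNat p (n + p ^ N)) =
      PadicInt.toZModPow N (padicGammaNat p n) := by
  rcases Nat.eq_zero_or_pos N with rfl | hN
  · have : Subsingleton (ZMod (p ^ 0)) := by rw [pow_zero]; infer_instance
    exact Subsingleton.elim _ _
  classical
  have : NeZero (p ^ N) := ⟨pow_ne_zero _ (Nat.Prime.ne_zero Fact.out)⟩
  rw [padicGammaNat_eq_prod, padicGammaNat_eq_prod, Finset.range_eq_Ico,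
    ← Finset.prod_Ico_consecutive _ (Nat.zero_le n) (Nat.le_add_right n (p ^ N)), map_mul,
    ← Finset.range_eq_Ico]
  conv_rhs => rw [← mul_one (PadicInt.toZModPow N _)]
  congr 1
  rw [Finset.prod_neg, Nat.card_Ico, Nat.add_sub_cancel_left, (hp.pow).neg_one_pow, map_mul,
    map_prod]
  rw [Finset.prod_congr rfl (fun k _ => toZModPow_unitPart hN.ne' k),
    ZMod.prod_Ico_eq_prod_univ (p ^ N) (fun x => if IsUnit x then x else 1) n]
  have : ∏ x : ZMod (p ^ N), (if IsUnit x then x else 1) =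
      ((∏ u : (ZMod (p ^ N))ˣ, u : (ZMod (p ^ N))ˣ) : ZMod (p ^ N)) := by
    rw [← Finset.prod_filter, Units.coe_prod]
    symm
    refine Finset.prod_bij (fun u _ => (u : ZMod (p ^ N))) ?_ ?_ ?_ (fun _ _ => rfl)
    · intro u _; simp
    · intro u _ v _ h; exact Units.ext h
    · intro x hx
      simp only [Finset.mem_filter, Finset.mem_univ, true_and] at hx
      exact ⟨hx.unit, Finset.mem_univ _, rfl⟩
  rw [this, ZMod.prod_units_prime_pow hp hN.ne']
  simp

theorem toZModPow_padicGammaNat_congr (hp : Odd p) (N : ℕ) {m n : ℕ} (h : m ≡ n [MOD p ^ N]) :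
    PadicInt.toZModPow N (padicGammaNat p m) = PadicInt.toZModPow N (padicGammaNat p n) := by
  have step : ∀ c n : ℕ, PadicInt.toZModPow N (padicGammaNat p (n + p ^ N * c)) =
      PadicInt.toZModPow N (padicGammaNat p n) := by
    intro c n
    induction c with
    | zero => simp
    | succ c ih => rw [mul_add, mul_one, ← add_assoc, toZModPow_padicGammaNat_add hp, ih]
  wlog hmn : m ≤ n generalizing m n
  · exact (this h.symm (le_of_not_ge hmn)).symm
  obtain ⟨c, hc⟩ := (Nat.modEq_iff_dvd' hmn).mp h
  rw [show n = m + p ^ N * c by omega, step]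

theorem PadicInt.toZModPow_eq_iff_dvd (N : ℕ) (x y : ℤ_[p]) :
    PadicInt.toZModPow N x = PadicInt.toZModPow N y ↔ (p : ℤ_[p]) ^ N ∣ x - y := by
  rw [← Ideal.mem_span_singleton, ← PadicInt.ker_toZModPow, RingHom.mem_ker, map_sub, sub_eq_zero]

theorem PadicInt.norm_le_iff_dvd (N : ℕ) (x : ℤ_[p]) :
    ‖x‖ ≤ (p : ℝ) ^ (-(N : ℤ)) ↔ (p : ℤ_[p]) ^ N ∣ x := by
  rw [PadicInt.norm_le_pow_iff_mem_span_pow, Ideal.mem_span_singleton]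

theorem padicGammaNat_congr (hp : Odd p) (N : ℕ) {m n : ℕ}
    (h : (p : ℤ_[p]) ^ N ∣ (m : ℤ_[p]) - n) :
    (p : ℤ_[p]) ^ N ∣ padicGammaNat p m - padicGammaNat p n := by
  rw [← PadicInt.toZModPow_eq_iff_dvd] at h ⊢
  apply toZModPow_padicGammaNat_congr hp
  simpa [ZMod.natCast_eq_natCast_iff] using h

theorem comap_natCast_nhds_neBot (x : ℤ_[p]) :
    NeBot (comap (fun n : ℕ => (n : ℤ_[p])) (𝓝 x)) :=
  comap_neBot fun _ ht => PadicInt.denseRange_natCast.mem_nhds ht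

theorem tendsto_padicGammaNat (hp : Odd p) (x : ℤ_[p]) :
    Tendsto (padicGammaNat p) (comap (fun n : ℕ => (n : ℤ_[p])) (𝓝 x))
      (𝓝 (padicGamma p x)) := by
  have : NeBot (comap (fun n : ℕ => (n : ℤ_[p])) (𝓝 x)) :=
    comap_natCast_nhds_neBot x
  refine tendsto_nhds_limUnder ?_
  refine cauchy_map_iff_exists_tendsto.mp ?_
  rw [Metric.cauchy_iff]
  refine ⟨inferInstance, fun ε hε => ?_⟩
  obtain ⟨N, hN⟩ := PadicInt.exists_pow_neg_lt p hε
  refine ⟨padicGammaNat p '' {n | (p : ℤ_[p]) ^ N ∣ (n : ℤ_[p]) - x}, ?_, ?_⟩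
  · apply image_mem_map
    refine ⟨Metric.closedBall x ((p : ℝ) ^ (-(N : ℤ))), ?_, ?_⟩
    · apply Metric.closedBall_mem_nhds
      have : (0 : ℝ) < p := by exact_mod_cast (Fact.out : p.Prime).pos
      positivity
    · intro n hn
      simp only [Set.mem_preimage, Metric.mem_closedBall, dist_eq_norm] at hn
      exact (PadicInt.norm_le_iff_dvd N _).mp hn
  · rintro _ ⟨m, hm, rfl⟩ _ ⟨n, hn, rfl⟩
    refine lt_of_le_of_lt ?_ hN
    rw [dist_eq_norm, PadicInt.norm_le_iff_dvd]
    apply padicGammaNat_congr hp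
    have := dvd_sub hm hn
    simpa using this

theorem padicGamma_sub_padicGammaNat (hp : Odd p) (N : ℕ) {x : ℤ_[p]} {n : ℕ}
    (h : (p : ℤ_[p]) ^ N ∣ x - n) : (p : ℤ_[p]) ^ N ∣ padicGamma p x - padicGammaNat p n := by
  have : NeBot (comap (fun n : ℕ => (n : ℤ_[p])) (𝓝 x)) :=
    comap_natCast_nhds_neBot x
  rw [← PadicInt.norm_le_iff_dvd]
  refine le_of_tendsto (((tendsto_padicGammaNat hp x).sub_const (padicGammaNat p n)).norm) ?_
  refine ⟨Metric.closedBall x ((p : ℝ) ^ (-(N : ℤ))), ?_, ?_⟩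
  · apply Metric.closedBall_mem_nhds
    have : (0 : ℝ) < p := by exact_mod_cast (Fact.out : p.Prime).pos
    positivity
  · intro m hm
    simp only [Set.mem_preimage, Metric.mem_closedBall, dist_eq_norm] at hm
    have hm := (PadicInt.norm_le_iff_dvd N _).mp hm
    refine (PadicInt.norm_le_iff_dvd N _).mpr (padicGammaNat_congr hp N ?_)
    have := dvd_add hm h
    simpa using this

theorem PadicInt.exists_natCast_congr (N : ℕ) (x : ℤ_[p]) :
    ∃ n : ℕ, (p : ℤ_[p]) ^ N ∣ x - n :=
  ⟨x.appr N, Ideal.mem_span_singleton.mp (PadicInt.appr_spec N x)⟩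

theorem padicGamma_congr (hp : Odd p) (N : ℕ) {x y : ℤ_[p]} (h : (p : ℤ_[p]) ^ N ∣ x - y) :
    (p : ℤ_[p]) ^ N ∣ padicGamma p x - padicGamma p y := by
  obtain ⟨n, hn⟩ := PadicInt.exists_natCast_congr N y
  have h1 := padicGamma_sub_padicGammaNat hp N hn
  have h2 := padicGamma_sub_padicGammaNat (x := x) (n := n) hp N
    (by simpa using dvd_add h hn)
  simpa using dvd_sub h2 h1

theorem PadicInt.eq_of_forall_pow_dvd {x y : ℤ_[p]} (h : ∀ N, (p : ℤ_[p]) ^ (N + 1) ∣ x - y) :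
    x = y := by
  rw [← PadicInt.ext_of_toZModPow]
  intro N
  rw [PadicInt.toZModPow_eq_iff_dvd]
  exact (pow_dvd_pow _ (Nat.le_succ N)).trans (h N)

theorem padicGamma_natCast (hp : Odd p) (n : ℕ) : padicGamma p n = padicGammaNat p n :=
  PadicInt.eq_of_forall_pow_dvd fun N => padicGamma_sub_padicGammaNat hp (N + 1) (by simp)

theorem unitPart_congr {N : ℕ} {x y : ℤ_[p]} (h : (p : ℤ_[p]) ^ (N + 1) ∣ x - y) :
    (p : ℤ_[p]) ^ (N + 1) ∣ unitPart p x - unitPart p y := by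
  have h1 : (p : ℤ_[p]) ∣ x - y := (dvd_pow_self _ (Nat.succ_ne_zero N)).trans h
  by_cases hy : (p : ℤ_[p]) ∣ y
  · have hx : (p : ℤ_[p]) ∣ x := by simpa using dvd_add h1 hy
    simp [unitPart_of_dvd hx, unitPart_of_dvd hy]
  · have hx : ¬ (p : ℤ_[p]) ∣ x := fun hx => hy (by simpa using dvd_sub hx h1)
    rwa [unitPart_of_not_dvd hx, unitPart_of_not_dvd hy]

theorem padicGamma_add_one (hp : Odd p) (x : ℤ_[p]) :
    padicGamma p (x + 1) = -unitPart p x * padicGamma p x := by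
  refine PadicInt.eq_of_forall_pow_dvd fun N => ?_
  obtain ⟨n, hn⟩ := PadicInt.exists_natCast_congr (N + 1) x
  have h1 := padicGamma_sub_padicGammaNat hp (N + 1) hn
  have h2 := padicGamma_sub_padicGammaNat (x := x + 1) (n := n + 1) hp (N + 1)
    (by simpa using hn)
  have h3 := unitPart_congr hn
  rw [padicGammaNat_succ] at h2
  have := dvd_add h2 (dvd_add (dvd_mul_of_dvd_left h3 (padicGamma p x))
    (dvd_mul_of_dvd_right h1 (unitPart p (n : ℤ_[p]))))
  convert this using 1
  ring

theorem padicGamma_zero (hp : Odd p) : padicGamma p 0 = 1 := by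
  have := padicGamma_natCast hp 0
  simpa [padicGammaNat] using this

theorem isUnit_padicGamma (hp : Odd p) (x : ℤ_[p]) : IsUnit (padicGamma p x) := by
  obtain ⟨n, hn⟩ := PadicInt.exists_natCast_congr 1 x
  have h1 := padicGamma_sub_padicGammaNat hp 1 hn
  rw [pow_one] at h1
  have h2 : IsUnit (padicGammaNat p n) := by
    rw [padicGammaNat_eq_prod]
    exact Finset.prod_induction _ IsUnit (fun _ _ => IsUnit.mul) isUnit_one
      (fun k _ => (isUnit_unitPart _).neg)
  rw [PadicInt.isUnit_iff_not_dvd] at h2 ⊢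
  intro h
  exact h2 (by simpa using dvd_sub h h1)

theorem padicGamma_add_natCast (hp : Odd p) (x : ℤ_[p]) (n : ℕ) :
    padicGamma p (x + n) =
      (-1) ^ n * (∏ j ∈ Finset.range n, unitPart p (x + j)) * padicGamma p x := by
  induction n with
  | zero => simp
  | succ n ih =>
    rw [Nat.cast_succ, ← add_assoc, padicGamma_add_one hp, ih, Finset.prod_range_succ]
    ring

end

section
variable {K : Type*} [Field K] [CharZero K]

theorem Nat.cast_choose_succ_right (n k : ℕ) :
    (n.choose (k + 1) : K) = n.choose k * (n - k) / (k + 1) := by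
  have h0 : (k + 1 : K) ≠ 0 := by exact_mod_cast Nat.succ_ne_zero k
  rw [eq_div_iff h0]
  rcases le_or_gt k n with h | h
  · have := Nat.choose_succ_right_eq n k
    have := congrArg (Nat.cast : ℕ → K) this
    push_cast [Nat.cast_sub h] at this
    exact this
  · rw [Nat.choose_eq_zero_of_lt h, Nat.choose_eq_zero_of_lt (by omega)]
    simp

theorem dixon_step_telescope (a b : K) (n : ℕ) (h1 : ∀ j ≤ n, 1 + a - b + (j : K) ≠ 0)
    (h2 : ∀ j : ℕ, 1 + a + (j : K) ≠ 0) (V : ℕ → K)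
    (hV : ∀ k ≤ n, V (k + 1) = V k * ((a + k) * (b + k) /
      ((1 + a - b + k) * (1 + a + n + k)))) (k : ℕ) (hk : k ≤ n + 1) :
    ∑ i ∈ Finset.range (k + 1), (-1) ^ i * ((1 + a / 2 + n) * (1 + a - b + n) *
        (n + 1).choose i / (1 + a + n + i) - (1 + a / 2 - b + n) * n.choose i) * V i =
      1 / 2 * (-1) ^ k * n.choose k * V k * (a + k) * (b + k) / (1 + a + n + k) := by
  have h2' : ∀ j : ℕ, 1 + a + (n : K) + (j : K) ≠ 0 := fun j => by
    have := h2 (n + j); push_cast at this; rwa [← add_assoc] at this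
  induction k with
  | zero =>
    have := h2' 0
    simp only [Nat.cast_zero, add_zero] at this
    simp
    field_simp
    ring
  | succ k ih =>
    rw [Finset.sum_range_succ, ih (by omega), hV k (by omega), Nat.choose_succ_succ' n k]
    push_cast
    rw [Nat.cast_choose_succ_right]
    have e1 := h1 k (by omega)
    have e2 := h2' k
    have e3 := h2' (k + 1)
    push_cast at e3
    have e4 : (k + 1 : K) ≠ 0 := by exact_mod_cast Nat.succ_ne_zero k
    field_simp
    ring

/-- Dixon's summation of the well-poised `₃F₂` at `1`, terminating case. -/
theorem dixon_terminating (a b : K) (n : ℕ) (h1 : ∀ j < n, 1 + a - b + (j : K) ≠ 0)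
    (h2 : ∀ j : ℕ, 1 + a + (j : K) ≠ 0) (h3 : ∀ j : ℕ, 1 + a / 2 + (j : K) ≠ 0) :
    ∑ k ∈ Finset.range (n + 1), (-1) ^ k * n.choose k *
        ∏ j ∈ Finset.range k, (a + j) * (b + j) / ((1 + a - b + j) * (1 + a + n + j)) =
      ∏ j ∈ Finset.range n, (1 + a + j) * (1 + a / 2 - b + j) /
        ((1 + a / 2 + j) * (1 + a - b + j)) := by
  induction n with
  | zero => simp
  | succ n ih =>
    rw [Finset.prod_range_succ, ← ih (fun j hj => h1 j (by omega))]
    set V : ℕ → K := fun k => ∏ j ∈ Finset.range k,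
      (a + j) * (b + j) / ((1 + a - b + j) * (1 + a + n + j)) with hVdef
    have h2' : ∀ j : ℕ, 1 + a + (n : K) + (j : K) ≠ 0 := fun j => by
      have := h2 (n + j); push_cast at this; rwa [← add_assoc] at this
    have hV' : ∀ k : ℕ, ∏ j ∈ Finset.range k, (a + j) * (b + j) /
        ((1 + a - b + j) * (1 + a + ((n + 1 : ℕ) : K) + j)) =
        V k * (1 + a + n) / (1 + a + n + k) := by
      intro k
      induction k with
      | zero =>
        have := h2' 0
        simp only [Nat.cast_zero, add_zero] at this
        simp [hVdef, this]
      | succ k ihk =>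
        rw [Finset.prod_range_succ, ihk]
        simp only [hVdef, Finset.prod_range_succ]
        have e2 := h2' k
        have e3 := h2' (k + 1)
        push_cast at e3 ⊢
        have e5 : 1 + a + ((n : K) + 1) + k ≠ 0 := by convert e3 using 1; ring
        by_cases e1 : 1 + a - b + (k : K) = 0
        · simp [e1]
        · rw [show 1 + a + (n : K) + (k + 1) = 1 + a + (n + 1) + k by ring]
          field_simp
    have tel := dixon_step_telescope a b n (fun j hj => h1 j (by omega)) h2 V
      (fun k _ => by simp only [hVdef, Finset.prod_range_succ]) (n + 1) le_rfl
    rw [Nat.choose_succ_self] at tel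
    simp only [Nat.cast_zero, mul_zero, zero_mul, zero_div] at tel
    have hsum : ∑ i ∈ Finset.range (n + 1 + 1), (-1 : K) ^ i * n.choose i * V i =
        ∑ i ∈ Finset.range (n + 1), (-1 : K) ^ i * n.choose i * V i := by
      rw [Finset.sum_range_succ, Nat.choose_succ_self]
      simp
    have e1 := h1 n (by omega)
    have e3 := h3 n
    rw [← hsum]
    have e : (1 + a / 2 + n) * (1 + a - b + n) *
        ∑ k ∈ Finset.range (n + 1 + 1), (-1) ^ k * ((n + 1).choose k : K) *
          ∏ j ∈ Finset.range k, (a + j) * (b + j) /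
            ((1 + a - b + j) * (1 + a + ((n + 1 : ℕ) : K) + j)) -
        (1 + a + n) * (1 + a / 2 - b + n) *
          ∑ i ∈ Finset.range (n + 1 + 1), (-1 : K) ^ i * n.choose i * V i = 0 := by
      rw [← mul_zero (1 + a + (n : K)), ← tel, Finset.mul_sum, Finset.mul_sum, Finset.mul_sum,
        ← Finset.sum_sub_distrib]
      refine Finset.sum_congr rfl fun k _ => ?_
      rw [hV' k]
      have := h2' k
      field_simp
    rw [mul_div_assoc', eq_div_iff (mul_ne_zero e3 e1)]
    linear_combination e

theorem prod_range_neg_add_div (n k : ℕ) :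
    ∏ j ∈ Finset.range k, (-(n : K) + j) / (j + 1) = (-1) ^ k * n.choose k := by
  induction k with
  | zero => simp
  | succ k ih =>
    rw [Finset.prod_range_succ, ih, Nat.cast_choose_succ_right]
    ring

/-- Summand of the well-poised series with upper parameters `a`, `a - s`, `a + s`, `s² = q`. -/
def wellPoisedTerm (a q : K) (k : ℕ) : K :=
  ∏ j ∈ Finset.range k, (a + j) * ((a + j) ^ 2 - q) / ((j + 1) * ((j + 1) ^ 2 - q))

/-- Sum of the first `N` terms of the well-poised series. -/
def wellPoisedSum (a q : K) (N : ℕ) : K := ∑ k ∈ Finset.range N, wellPoisedTerm a q k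

theorem wellPoisedSum_eq_prod (a : K) (n : ℕ) {N : ℕ} (hN : n < N)
    (h1 : ∀ j < n, 1 - a - n + (j : K) ≠ 0)
    (h2 : ∀ j : ℕ, 1 + a + (j : K) ≠ 0) (h3 : ∀ j : ℕ, 1 + a / 2 + (j : K) ≠ 0) :
    wellPoisedSum a ((a + n) ^ 2) N = ∏ j ∈ Finset.range n, (1 + a + j) *
      (1 - 3 * (a / 2) - n + j) / ((1 + a / 2 + j) * (1 - a - n + j)) := by
  have hd := dixon_terminating a (2 * a + n) n (fun j hj => by
    convert h1 j hj using 1; ring) h2 h3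
  have hr : ∏ j ∈ Finset.range n, (1 + a + (j : K)) * (1 - 3 * (a / 2) - n + j) /
      ((1 + a / 2 + j) * (1 - a - n + j)) = ∏ j ∈ Finset.range n, (1 + a + j) *
      (1 + a / 2 - (2 * a + n) + j) / ((1 + a / 2 + j) * (1 + a - (2 * a + n) + j)) := by
    refine Finset.prod_congr rfl fun j _ => ?_
    ring_nf
  rw [hr, ← hd, wellPoisedSum]
  have hterm : ∀ k, wellPoisedTerm a ((a + n) ^ 2) k = (-1) ^ k * n.choose k *
      ∏ j ∈ Finset.range k, (a + j) * ((2 * a + n) + j) /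
        ((1 + a - (2 * a + n) + j) * (1 + a + n + j)) := by
    intro k
    rw [← prod_range_neg_add_div, ← Finset.prod_mul_distrib, wellPoisedTerm]
    refine Finset.prod_congr rfl fun j _ => ?_
    rw [div_mul_div_comm]
    congr 1 <;> ring
  rw [Finset.sum_congr rfl fun k _ => hterm k]
  symm
  refine Finset.sum_subset (Finset.range_mono hN) fun k _ hk => ?_
  rw [Nat.choose_eq_zero_of_lt (by simpa using hk)]
  simp

/-- `∏_{j=1}^{k} 1 / (j (j² - q))`. -/
def cubicInvFactorial (q : K) (k : ℕ) : K :=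
  ∏ j ∈ Finset.range k, 1 / (((j : K) + 1) ^ 3 - q * (j + 1))

/-- Alternating self-convolution of `cubicInvFactorial`. -/
def cubicConvolution (q : K) (n : ℕ) : K :=
  ∑ k ∈ Finset.range (n + 1),
    (-1) ^ k * cubicInvFactorial q k * cubicInvFactorial q (n - k)

theorem cube_sub_ne_zero {q : K} {j : ℕ} (h : ((j : K) + 1) ^ 2 - q ≠ 0) :
    ((j : K) + 1) ^ 3 - q * (j + 1) ≠ 0 := by
  have e4 : (j + 1 : K) ≠ 0 := by exact_mod_cast Nat.succ_ne_zero j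
  rw [show ((j : K) + 1) ^ 3 - q * (j + 1) = (j + 1) * ((j + 1) ^ 2 - q) by ring]
  exact mul_ne_zero e4 h

theorem cubicInvFactorial_succ {q : K} {j : ℕ} (h : ((j : K) + 1) ^ 2 - q ≠ 0) :
    cubicInvFactorial q j = cubicInvFactorial q (j + 1) * (((j : K) + 1) ^ 3 - q * (j + 1)) := by
  rw [cubicInvFactorial, cubicInvFactorial, Finset.prod_range_succ, mul_assoc,
    one_div_mul_cancel (cube_sub_ne_zero h), mul_one]

theorem cubicInvFactorial_ne_zero {q : K} {n : ℕ} (h : ∀ j < n, ((j : K) + 1) ^ 2 - q ≠ 0) :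
    cubicInvFactorial q n ≠ 0 := by
  rw [cubicInvFactorial, Finset.prod_ne_zero_iff]
  intro j hj
  exact one_div_ne_zero (cube_sub_ne_zero (h j (Finset.mem_range.mp hj)))

theorem cubicConvolution_of_odd (q : K) {n : ℕ} (hn : Odd n) : cubicConvolution q n = 0 := by
  have h : cubicConvolution q n = -cubicConvolution q n := by
    conv_lhs => rw [cubicConvolution]
    rw [← Finset.sum_flip, cubicConvolution, ← Finset.sum_neg_distrib]
    refine Finset.sum_congr rfl fun k hk => ?_
    have hk : k ≤ n := by simpa [Nat.lt_succ_iff] using hk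
    rw [Nat.sub_sub_self hk]
    have : (-1 : K) ^ (n - k) = -(-1) ^ k := by
      have h2 : (-1 : K) ^ (n - k) * (-1) ^ k = -1 := by
        rw [← pow_add, Nat.sub_add_cancel hk, hn.neg_one_pow]
      have h3 : (-1 : K) ^ k * (-1) ^ k = 1 := by
        rw [← pow_add, (Even.add_self k).neg_one_pow]
      linear_combination (-1 : K) ^ k * h2 - (-1 : K) ^ (n - k) * h3
    rw [this]
    ring
  exact self_eq_neg.mp h

/-- The rational certificate behind the two-step recurrence of `cubicConvolution`. -/
def convolutionCertificate (q h x : K) : K :=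
  let c2 := -(3 / 2) * (3 * h - 1)
  let c1 := 3 / 2 * (3 * h - 2) * (3 * h ^ 2 + 2 * q) -
    3 / 4 * (1 - 9 * h + 12 * h ^ 2 - 2 * h ^ 3 + 2 * h * q - 4 * q)
  let c0 := (3 * (3 * h - 1) * (3 * h - 2) * (h * (h ^ 2 - q)) -
    2 * (2 * h - 1) * ((2 * h - 1) ^ 2 - q) * (4 * h ^ 2 - q)) / 2 - c1 / 4 - c2 / 16
  c0 + c1 * x ^ 2 + c2 * x ^ 4

theorem convolutionCertificate_spec (q h k l : K) (hkl : k + l = 2 * h) :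
    2 * (2 * h - 1) * (h * (h ^ 2 - q)) * ((2 * h - 1) ^ 2 - q) * (4 * h ^ 2 - q) -
      3 * (3 * h - 1) * (3 * h - 2) * (k ^ 3 - q * k) * (l ^ 3 - q * l) =
    -convolutionCertificate q h (k - h + 1 / 2) * (l ^ 3 - q * l) -
      convolutionCertificate q h (k - h - 1 / 2) * (k ^ 3 - q * k) := by
  obtain rfl : l = 2 * h - k := by linear_combination hkl
  simp only [convolutionCertificate]
  ring

theorem cubicConvolution_telescope (q : K) (n : ℕ) (hq : ∀ j < n, ((j : K) + 1) ^ 2 - q ≠ 0)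
    (h : K) (hh : (n : K) = 2 * h) (k : ℕ) (hk : k ≤ n) :
    ∑ i ∈ Finset.range (k + 1),
      (2 * (2 * h - 1) * (h * (h ^ 2 - q)) * ((2 * h - 1) ^ 2 - q) * (4 * h ^ 2 - q) -
        3 * (3 * h - 1) * (3 * h - 2) * ((i : K) ^ 3 - q * i) *
          (((n - i : ℕ) : K) ^ 3 - q * (n - i : ℕ))) *
        ((-1) ^ i * cubicInvFactorial q i * cubicInvFactorial q (n - i)) =
      -convolutionCertificate q h (k - h + 1 / 2) *
        (((n - k : ℕ) : K) ^ 3 - q * (n - k : ℕ)) *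
        ((-1) ^ k * cubicInvFactorial q k * cubicInvFactorial q (n - k)) := by
  induction k with
  | zero =>
    rw [Finset.sum_range_one, convolutionCertificate_spec]
    · simp
    · simp [hh]
  | succ k ih =>
    rw [Finset.sum_range_succ, ih (by omega), convolutionCertificate_spec]
    · obtain ⟨l, hl⟩ : ∃ l, n = k + l + 1 := ⟨n - k - 1, by omega⟩
      rw [show n - k = l + 1 by omega, show n - (k + 1) = l by omega,
        cubicInvFactorial_succ (hq k (by omega)), cubicInvFactorial_succ (hq l (by omega))]
      push_cast
      rw [show (k : K) + 1 - h - 1 / 2 = k - h + 1 / 2 by ring]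
      ring
    · rw [← hh, ← Nat.cast_add, Nat.add_sub_cancel' hk]

theorem cubicConvolution_add_two (q : K) (n : ℕ)
    (hq : ∀ j < n + 2, ((j : K) + 1) ^ 2 - q ≠ 0) (h : K) (hh : (n : K) + 2 = 2 * h) :
    2 * (2 * h - 1) * (h * (h ^ 2 - q)) * ((2 * h - 1) ^ 2 - q) * (4 * h ^ 2 - q) *
        cubicConvolution q (n + 2) =
      -(3 * (3 * h - 1) * (3 * h - 2)) * cubicConvolution q n := by
  have tel := cubicConvolution_telescope q (n + 2) hq h (by push_cast; exact hh) (n + 2) le_rfl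
  rw [Nat.sub_self] at tel
  simp only [Nat.cast_zero, mul_zero, ne_eq, OfNat.ofNat_ne_zero, not_false_eq_true, zero_pow,
    sub_zero, zero_mul] at tel
  have hmid : ∑ i ∈ Finset.range (n + 2 + 1),
      3 * (3 * h - 1) * (3 * h - 2) * ((i : K) ^ 3 - q * i) *
          (((n + 2 - i : ℕ) : K) ^ 3 - q * (n + 2 - i : ℕ)) *
        ((-1) ^ i * cubicInvFactorial q i * cubicInvFactorial q (n + 2 - i)) =
      -(3 * (3 * h - 1) * (3 * h - 2)) * cubicConvolution q n := by
    rw [Finset.sum_range_succ, Finset.sum_range_succ', cubicConvolution, Finset.mul_sum]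
    rw [Nat.sub_self]
    simp only [Nat.cast_zero, mul_zero, ne_eq, OfNat.ofNat_ne_zero, not_false_eq_true, zero_pow,
      sub_zero, zero_mul, add_zero]
    refine Finset.sum_congr rfl fun k hk => ?_
    have hk : k < n + 1 := Finset.mem_range.mp hk
    obtain ⟨l, rfl⟩ : ∃ l, n = k + l := ⟨n - k, by omega⟩
    rw [show k + l + 2 - (k + 1) = l + 1 by omega, show k + l - k = l by omega,
      cubicInvFactorial_succ (hq k (by omega)), cubicInvFactorial_succ (hq l (by omega))]
    push_cast
    ring
  rw [← hmid, ← sub_eq_zero, ← tel, cubicConvolution, Finset.mul_sum, ← Finset.sum_sub_distrib]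
  exact Finset.sum_congr rfl fun k _ => (sub_mul _ _ _).symm

theorem cubicConvolution_even (q : K) (m : ℕ)
    (hq : ∀ j < 2 * m, ((j : K) + 1) ^ 2 - q ≠ 0) :
    cubicConvolution q (2 * m) * ∏ j ∈ Finset.range m, (((j : K) + 1) ^ 2 - q) =
      (-1) ^ m * ((3 * m).factorial / m.factorial) * cubicInvFactorial q (2 * m) := by
  induction m with
  | zero => simp [cubicConvolution, cubicInvFactorial]
  | succ m ih =>
    have ih := ih fun j hj => hq j (by omega)
    have hrec := cubicConvolution_add_two q (2 * m) (fun j hj => hq j (by omega)) (m + 1)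
      (by push_cast; ring)
    have e0 : (m + 1 : K) ≠ 0 := by exact_mod_cast Nat.succ_ne_zero m
    have ef : (m.factorial : K) ≠ 0 := by exact_mod_cast m.factorial_ne_zero
    have f1 : ((3 * (m + 1)).factorial : K) =
        3 * (m + 1) * (3 * m + 2) * (3 * m + 1) * (3 * m).factorial := by
      rw [show 3 * (m + 1) = 3 * m + 2 + 1 by ring, Nat.factorial_succ, Nat.factorial_succ,
        Nat.factorial_succ]
      push_cast
      ring
    have f2 : ((m + 1).factorial : K) = (m + 1) * m.factorial := by
      rw [Nat.factorial_succ]; push_cast; ring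
    have c1 := cubicInvFactorial_succ (hq (2 * m) (by omega))
    have c2 := cubicInvFactorial_succ (hq (2 * m + 1) (by omega))
    have n1 := cube_sub_ne_zero (hq (2 * m) (by omega))
    have n2 := cube_sub_ne_zero (hq (2 * m + 1) (by omega))
    rw [show 2 * (m + 1) = 2 * m + 1 + 1 by ring, Finset.prod_range_succ, f1, f2, pow_succ]
    rw [c1, c2] at ih
    push_cast at *
    have e : (3 * ((m : K) + 1) * (3 * m + 2) * (3 * m + 1) * (3 * m).factorial) /
        ((m + 1) * m.factorial) = 3 * (3 * m + 2) * (3 * m + 1) *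
          ((3 * m).factorial / m.factorial) := by
      field_simp
    rw [e]
    refine mul_left_cancel₀ (mul_ne_zero n1 n2) ?_
    linear_combination (∏ j ∈ Finset.range m, (((j : K) + 1) ^ 2 - q)) * hrec -
      3 * (3 * m + 2) * (3 * m + 1) * ih

theorem wellPoisedTerm_neg (q : K) (n : ℕ) (hq : ∀ j < n, ((j : K) + 1) ^ 2 - q ≠ 0) (k : ℕ)
    (hk : k ≤ n) : wellPoisedTerm (-(n : K)) q k * cubicInvFactorial q n =
      (-1) ^ k * cubicInvFactorial q k * cubicInvFactorial q (n - k) := by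
  induction k with
  | zero => simp [wellPoisedTerm, cubicInvFactorial]
  | succ k ih =>
    have ih := ih (by omega)
    obtain ⟨l, rfl⟩ : ∃ l, n = k + l + 1 := ⟨n - k - 1, by omega⟩
    have hs : wellPoisedTerm (-((k + l + 1 : ℕ) : K)) q (k + 1) =
        wellPoisedTerm (-((k + l + 1 : ℕ) : K)) q k * (-(((l : K) + 1) ^ 3 - q * (l + 1)) /
          (((k : K) + 1) ^ 3 - q * (k + 1))) := by
      rw [wellPoisedTerm, Finset.prod_range_succ, ← wellPoisedTerm]
      push_cast
      congr 1
      congr 1 <;> ring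
    rw [show k + l + 1 - k = l + 1 by omega, cubicInvFactorial_succ (hq k (by omega))] at ih
    rw [hs, show k + l + 1 - (k + 1) = l by omega, cubicInvFactorial_succ (hq l (by omega))]
    have := cube_sub_ne_zero (hq k (by omega))
    rw [mul_div_assoc', div_mul_eq_mul_div, div_eq_iff this, pow_succ]
    linear_combination -(((l : K) + 1) ^ 3 - q * (l + 1)) * ih

theorem wellPoisedTerm_neg_of_lt {K : Type*} [Field K] (q : K) {n k : ℕ} (hk : n < k) :
    wellPoisedTerm (-(n : K)) q k = 0 :=
  Finset.prod_eq_zero (Finset.mem_range.mpr hk) (by simp)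

theorem wellPoisedSum_neg (q : K) (n : ℕ) (hq : ∀ j < n, ((j : K) + 1) ^ 2 - q ≠ 0) {N : ℕ}
    (hN : n < N) : wellPoisedSum (-(n : K)) q N * cubicInvFactorial q n = cubicConvolution q n := by
  have : wellPoisedSum (-(n : K)) q N = wellPoisedSum (-(n : K)) q (n + 1) := by
    symm
    refine Finset.sum_subset (Finset.range_mono hN) fun k _ hk => ?_
    exact wellPoisedTerm_neg_of_lt q (by simpa using hk)
  rw [this, wellPoisedSum, Finset.sum_mul, cubicConvolution]
  refine Finset.sum_congr rfl fun k hk => wellPoisedTerm_neg q n hq k ?_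
  simpa [Nat.lt_succ_iff] using hk

theorem wellPoisedSum_neg_odd (q : K) {n : ℕ} (hn : Odd n)
    (hq : ∀ j < n, ((j : K) + 1) ^ 2 - q ≠ 0) {N : ℕ} (hN : n < N) :
    wellPoisedSum (-(n : K)) q N = 0 := by
  have h := wellPoisedSum_neg q n hq hN
  rw [cubicConvolution_of_odd q hn] at h
  exact (mul_eq_zero.mp h).resolve_right (cubicInvFactorial_ne_zero hq)

theorem wellPoisedSum_neg_even (q : K) (m : ℕ)
    (hq : ∀ j < 2 * m, ((j : K) + 1) ^ 2 - q ≠ 0) {N : ℕ} (hN : 2 * m < N) :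
    wellPoisedSum (-((2 * m : ℕ) : K)) q N = (-1) ^ m * ((3 * m).factorial / m.factorial) /
      ∏ j ∈ Finset.range m, (((j : K) + 1) ^ 2 - q) := by
  have h := wellPoisedSum_neg q (2 * m) hq hN
  have h0 : ∏ j ∈ Finset.range m, (((j : K) + 1) ^ 2 - q) ≠ 0 :=
    Finset.prod_ne_zero_iff.mpr fun j hj => hq j (by have := Finset.mem_range.mp hj; omega)
  rw [eq_div_iff h0]
  refine mul_right_cancel₀ (cubicInvFactorial_ne_zero hq) ?_
  rw [← cubicConvolution_even q m hq, ← h]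
  ring

end

/-- The fractional ideal `p ^ r ℤ_p` of `ℚ_p`. -/
def padicPow (p : ℕ) [Fact p.Prime] (r : ℕ) : AddSubgroup ℚ_[p] where
  carrier := {x | ‖x‖ ≤ (p : ℝ) ^ (-(r : ℤ))}
  zero_mem' := by
    simp only [Set.mem_ofPred_eq, norm_zero]
    positivity
  add_mem' := fun ha hb => (Padic.nonarchimedean _ _).trans (max_le ha hb)
  neg_mem' := fun ha => by simpa using ha

section
variable {p : ℕ} [Fact p.Prime]

theorem mem_padicPow {r : ℕ} {x : ℚ_[p]} : x ∈ padicPow p r ↔ ‖x‖ ≤ (p : ℝ) ^ (-(r : ℤ)) :=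
  Iff.rfl

theorem mem_padicPow_zero {x : ℚ_[p]} : x ∈ padicPow p 0 ↔ ‖x‖ ≤ 1 := by
  simp [mem_padicPow]

theorem mul_mem_padicPow {r s : ℕ} {x y : ℚ_[p]} (hx : x ∈ padicPow p r)
    (hy : y ∈ padicPow p s) : x * y ∈ padicPow p (r + s) := by
  rw [mem_padicPow] at *
  have : (p : ℝ) ≠ 0 := by exact_mod_cast (Fact.out : p.Prime).ne_zero
  rw [norm_mul, Nat.cast_add, neg_add, zpow_add₀ this]
  exact mul_le_mul hx hy (norm_nonneg _) (by positivity)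

theorem padicPow_mono {r s : ℕ} (h : r ≤ s) {x : ℚ_[p]} (hx : x ∈ padicPow p s) :
    x ∈ padicPow p r := by
  rw [mem_padicPow] at *
  refine hx.trans (zpow_le_zpow_right₀ ?_ (by omega))
  exact_mod_cast (Fact.out : p.Prime).one_lt.le

theorem mul_mem_padicPow_left {r : ℕ} {x y : ℚ_[p]} (hx : x ∈ padicPow p r)
    (hy : y ∈ padicPow p 0) : x * y ∈ padicPow p r := mul_mem_padicPow hx hy

theorem mul_mem_padicPow_right {r : ℕ} {x y : ℚ_[p]} (hx : x ∈ padicPow p 0)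
    (hy : y ∈ padicPow p r) : x * y ∈ padicPow p r := by
  rw [mul_comm]; exact mul_mem_padicPow_left hy hx

theorem coe_mem_padicPow_iff {r : ℕ} {x : ℤ_[p]} :
    (x : ℚ_[p]) ∈ padicPow p r ↔ (p : ℤ_[p]) ^ r ∣ x := by
  rw [mem_padicPow, ← PadicInt.norm_le_iff_dvd, PadicInt.norm_def]

theorem coe_mem_padicPow_zero (x : ℤ_[p]) : (x : ℚ_[p]) ∈ padicPow p 0 :=
  coe_mem_padicPow_iff.mpr (by simp)

theorem natCast_mem_padicPow_zero (n : ℕ) : (n : ℚ_[p]) ∈ padicPow p 0 := by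
  simpa using coe_mem_padicPow_zero (n : ℤ_[p])

theorem one_mem_padicPow_zero : (1 : ℚ_[p]) ∈ padicPow p 0 := by
  simpa using natCast_mem_padicPow_zero (p := p) 1

theorem prime_mem_padicPow_one : (p : ℚ_[p]) ∈ padicPow p 1 := by
  simpa using (coe_mem_padicPow_iff (x := (p : ℤ_[p])) (r := 1)).mpr (by simp)

theorem padicCongr_iff {r : ℕ} {x y : ℚ_[p]} : PadicCongr p r x y ↔ x - y ∈ padicPow p r := by
  have hp0 : (p : ℚ_[p]) ≠ 0 := by exact_mod_cast (Fact.out : p.Prime).ne_zero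
  have hp1 : (p : ℝ) ≠ 0 := by exact_mod_cast (Fact.out : p.Prime).ne_zero
  constructor
  · rintro ⟨c, hc⟩
    rw [hc]
    have : ((p ^ r * c : ℤ_[p]) : ℚ_[p]) ∈ padicPow p r :=
      coe_mem_padicPow_iff.mpr (dvd_mul_right _ _)
    simpa using this
  · intro h
    rw [mem_padicPow] at h
    refine ⟨⟨(x - y) / p ^ r, ?_⟩, ?_⟩
    · rw [norm_div, norm_pow, Padic.norm_p, inv_pow, div_inv_eq_mul]
      calc ‖x - y‖ * (p : ℝ) ^ r ≤ (p : ℝ) ^ (-(r : ℤ)) * (p : ℝ) ^ r := by gcongr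
        _ = 1 := by rw [zpow_neg, zpow_natCast]; field_simp
    · field_simp

theorem inv_mem_padicPow_zero {x : ℚ_[p]} (hx : ‖x‖ = 1) : x⁻¹ ∈ padicPow p 0 := by
  rw [mem_padicPow_zero, norm_inv, hx, inv_one]

theorem mem_padicPow_zero_of_norm {x : ℚ_[p]} (hx : ‖x‖ = 1) : x ∈ padicPow p 0 :=
  mem_padicPow_zero.mpr hx.le

theorem norm_eq_one_of_sub_mem {x y : ℚ_[p]} (hy : ‖y‖ = 1) (h : x - y ∈ padicPow p 1) :
    ‖x‖ = 1 := by
  have h1 : ‖x - y‖ < 1 := by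
    refine lt_of_le_of_lt (mem_padicPow.mp h) ?_
    rw [Nat.cast_one, zpow_neg_one]
    exact inv_lt_one_of_one_lt₀ (by exact_mod_cast (Fact.out : p.Prime).one_lt)
  have := Padic.add_eq_max_of_ne (p := p) (q := x - y) (r := y) (by rw [hy]; exact h1.ne)
  rw [sub_add_cancel, hy] at this
  rw [this]
  exact max_eq_right h1.le

theorem inv_sub_inv_mem {r : ℕ} {x y : ℚ_[p]} (hx : ‖x‖ = 1) (hy : ‖y‖ = 1)
    (h : x - y ∈ padicPow p r) : x⁻¹ - y⁻¹ ∈ padicPow p r := by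
  have hx0 : x ≠ 0 := norm_ne_zero_iff.mp (by rw [hx]; exact one_ne_zero)
  have hy0 : y ≠ 0 := norm_ne_zero_iff.mp (by rw [hy]; exact one_ne_zero)
  rw [show x⁻¹ - y⁻¹ = -(x - y) * (x⁻¹ * y⁻¹) by field_simp; ring]
  exact mul_mem_padicPow_left (neg_mem h)
    (mul_mem_padicPow (inv_mem_padicPow_zero hx) (inv_mem_padicPow_zero hy))

theorem mul_sub_mul_mem {r : ℕ} {x x' y y' : ℚ_[p]} (hx : x ∈ padicPow p 0)
    (hy' : y' ∈ padicPow p 0) (h : x - x' ∈ padicPow p r) (h' : y - y' ∈ padicPow p r) :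
    x * y - x' * y' ∈ padicPow p r := by
  rw [show x * y - x' * y' = x * (y - y') + (x - x') * y' by ring]
  exact add_mem (mul_mem_padicPow_right hx h') (mul_mem_padicPow_left h hy')

theorem norm_natCast_of_lt {j : ℕ} (h0 : 0 < j) (hj : j < p) : ‖(j : ℚ_[p])‖ = 1 := by
  rw [Padic.norm_natCast_eq_one_iff, Nat.Prime.coprime_iff_not_dvd Fact.out]
  exact Nat.not_dvd_of_pos_of_lt h0 hj

/-- `x, x'` are the values at `q` and `y, y'` those at `0` of an integral expression evaluated at
two parameters congruent modulo `p`, where `p² ∣ q`: the increments agree modulo `p³`. -/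
structure IncrementCongr (x x' y y' : ℚ_[p]) : Prop where
  left_mem : y ∈ padicPow p 0
  right_mem : y' ∈ padicPow p 0
  base : y - y' ∈ padicPow p 1
  left_incr : x - y ∈ padicPow p 2
  right_incr : x' - y' ∈ padicPow p 2
  incr : (x - y) - (x' - y') ∈ padicPow p 3

theorem IncrementCongr.mul {x x' y y' u u' v v' : ℚ_[p]} (h : IncrementCongr x x' y y')
    (k : IncrementCongr u u' v v') : IncrementCongr (x * u) (x' * u') (y * v) (y' * v') where
  left_mem := mul_mem_padicPow h.left_mem k.left_mem
  right_mem := mul_mem_padicPow h.right_mem k.right_mem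
  base := mul_sub_mul_mem h.left_mem k.right_mem h.base k.base
  left_incr := by
    rw [show x * u - y * v = y * (u - v) + (x - y) * v + (x - y) * (u - v) by ring]
    exact add_mem (add_mem (mul_mem_padicPow_right h.left_mem k.left_incr)
      (mul_mem_padicPow_left h.left_incr k.left_mem))
      (padicPow_mono (by norm_num) (mul_mem_padicPow h.left_incr k.left_incr))
  right_incr := by
    rw [show x' * u' - y' * v' = y' * (u' - v') + (x' - y') * v' + (x' - y') * (u' - v') by ring]
    exact add_mem (add_mem (mul_mem_padicPow_right h.right_mem k.right_incr)
      (mul_mem_padicPow_left h.right_incr k.right_mem))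
      (padicPow_mono (by norm_num) (mul_mem_padicPow h.right_incr k.right_incr))
  incr := by
    rw [show x * u - y * v - (x' * u' - y' * v') =
      (y * ((u - v) - (u' - v')) + (y - y') * (u' - v')) +
      (((x - y) - (x' - y')) * v + (x' - y') * (v - v')) +
      ((x - y) * (u - v) - (x' - y') * (u' - v')) by ring]
    refine add_mem (add_mem (add_mem ?_ ?_) (add_mem ?_ ?_)) (sub_mem ?_ ?_)
    · exact mul_mem_padicPow_right h.left_mem k.incr
    · exact mul_mem_padicPow h.base k.right_incr
    · exact mul_mem_padicPow_left h.incr k.left_mem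
    · exact mul_mem_padicPow h.right_incr k.base
    · exact padicPow_mono (by norm_num) (mul_mem_padicPow h.left_incr k.left_incr)
    · exact padicPow_mono (by norm_num) (mul_mem_padicPow h.right_incr k.right_incr)

theorem IncrementCongr.one : IncrementCongr (1 : ℚ_[p]) 1 1 1 where
  left_mem := one_mem_padicPow_zero
  right_mem := one_mem_padicPow_zero
  base := by simp [zero_mem]
  left_incr := by simp [zero_mem]
  right_incr := by simp [zero_mem]
  incr := by simp [zero_mem]

theorem IncrementCongr.prod {f f' g g' : ℕ → ℚ_[p]} (k : ℕ)
    (h : ∀ j < k, IncrementCongr (f j) (f' j) (g j) (g' j)) :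
    IncrementCongr (∏ j ∈ Finset.range k, f j) (∏ j ∈ Finset.range k, f' j)
      (∏ j ∈ Finset.range k, g j) (∏ j ∈ Finset.range k, g' j) := by
  induction k with
  | zero => simpa using IncrementCongr.one
  | succ k ih =>
    simp only [Finset.prod_range_succ]
    exact (ih fun j hj => h j (by omega)).mul (h k (by omega))

theorem IncrementCongr.const {x y : ℚ_[p]} (hx : x ∈ padicPow p 0) (hy : y ∈ padicPow p 0)
    (h : x - y ∈ padicPow p 1) : IncrementCongr x y x y where
  left_mem := hx
  right_mem := hy
  base := h
  left_incr := by simp [zero_mem]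
  right_incr := by simp [zero_mem]
  incr := by simp [zero_mem]

theorem sq_mem_padicPow_zero {x : ℚ_[p]} (hx : x ∈ padicPow p 0) : x ^ 2 ∈ padicPow p 0 := by
  rw [pow_two]; exact mul_mem_padicPow hx hx

theorem sq_sub_sq_mem {r : ℕ} {x y : ℚ_[p]} (hx : x ∈ padicPow p 0) (hy : y ∈ padicPow p 0)
    (h : x - y ∈ padicPow p r) : x ^ 2 - y ^ 2 ∈ padicPow p r := by
  rw [pow_two, pow_two]; exact mul_sub_mul_mem hx hy h h

theorem IncrementCongr.sq_sub {x y q : ℚ_[p]} (hx : x ∈ padicPow p 0) (hy : y ∈ padicPow p 0)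
    (h : x - y ∈ padicPow p 1) (hq : q ∈ padicPow p 2) :
    IncrementCongr (x ^ 2 - q) (y ^ 2 - q) (x ^ 2 - 0) (y ^ 2 - 0) where
  left_mem := by rw [sub_zero]; exact sq_mem_padicPow_zero hx
  right_mem := by rw [sub_zero]; exact sq_mem_padicPow_zero hy
  base := by simpa using sq_sub_sq_mem hx hy h
  left_incr := by simpa using hq
  right_incr := by simpa using hq
  incr := by simp [zero_mem]

theorem norm_sq_sub_eq_one {j : ℕ} (hj : j + 1 < p) {q : ℚ_[p]} (hq : q ∈ padicPow p 2) :
    ‖((j : ℚ_[p]) + 1) ^ 2 - q‖ = 1 := by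
  have h1 : ‖((j : ℚ_[p]) + 1)‖ = 1 := by
    exact_mod_cast norm_natCast_of_lt (p := p) (Nat.succ_pos j) hj
  refine norm_eq_one_of_sub_mem (y := ((j : ℚ_[p]) + 1) ^ 2) (by rw [norm_pow, h1, one_pow]) ?_
  rw [sub_sub_cancel_left]
  exact neg_mem (padicPow_mono (by norm_num) hq)

theorem IncrementCongr.denominator {j : ℕ} (hj : j + 1 < p) {q : ℚ_[p]} (hq : q ∈ padicPow p 2) :
    IncrementCongr (((j : ℚ_[p]) + 1) * (((j : ℚ_[p]) + 1) ^ 2 - q))⁻¹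
      (((j : ℚ_[p]) + 1) * (((j : ℚ_[p]) + 1) ^ 2 - q))⁻¹
      (((j : ℚ_[p]) + 1) * (((j : ℚ_[p]) + 1) ^ 2 - 0))⁻¹
      (((j : ℚ_[p]) + 1) * (((j : ℚ_[p]) + 1) ^ 2 - 0))⁻¹ := by
  have h1 : ‖((j : ℚ_[p]) + 1)‖ = 1 := by
    exact_mod_cast norm_natCast_of_lt (p := p) (Nat.succ_pos j) hj
  have hq1 : ‖((j : ℚ_[p]) + 1) * (((j : ℚ_[p]) + 1) ^ 2 - q)‖ = 1 := by
    rw [norm_mul, h1, norm_sq_sub_eq_one hj hq, one_mul]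
  have hq0 : ‖((j : ℚ_[p]) + 1) * (((j : ℚ_[p]) + 1) ^ 2 - 0)‖ = 1 := by
    rw [norm_mul, h1, norm_sq_sub_eq_one hj (zero_mem _), one_mul]
  have hd : (((j : ℚ_[p]) + 1) * (((j : ℚ_[p]) + 1) ^ 2 - q))⁻¹ -
      (((j : ℚ_[p]) + 1) * (((j : ℚ_[p]) + 1) ^ 2 - 0))⁻¹ ∈ padicPow p 2 := by
    refine inv_sub_inv_mem hq1 hq0 ?_
    rw [← mul_sub, sub_sub_sub_cancel_left, zero_sub]
    exact mul_mem_padicPow_right (mem_padicPow_zero_of_norm h1) (neg_mem hq)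
  exact ⟨inv_mem_padicPow_zero hq0, inv_mem_padicPow_zero hq0, by simp [zero_mem], hd, hd,
    by simp [zero_mem]⟩

theorem incrementCongr_wellPoisedTerm {a b q : ℚ_[p]} (ha : a ∈ padicPow p 0)
    (hb : b ∈ padicPow p 0) (hab : a - b ∈ padicPow p 1) (hq : q ∈ padicPow p 2) {k : ℕ}
    (hk : k < p) : IncrementCongr (wellPoisedTerm a q k) (wellPoisedTerm b q k)
      (wellPoisedTerm a 0 k) (wellPoisedTerm b 0 k) := by
  refine IncrementCongr.prod k fun j hj => ?_
  simp only [div_eq_mul_inv]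
  have ha' := add_mem ha (natCast_mem_padicPow_zero (p := p) j)
  have hb' := add_mem hb (natCast_mem_padicPow_zero (p := p) j)
  have hab' : a + j - (b + j) ∈ padicPow p 1 := by rwa [add_sub_add_right_eq_sub]
  exact ((IncrementCongr.const ha' hb' hab').mul (.sq_sub ha' hb' hab' hq)).mul
    (.denominator (by omega) hq)

theorem wellPoisedSum_increment {a b q : ℚ_[p]} (ha : a ∈ padicPow p 0)
    (hb : b ∈ padicPow p 0) (hab : a - b ∈ padicPow p 1) (hq : q ∈ padicPow p 2) :
    (wellPoisedSum a q p - wellPoisedSum a 0 p) - (wellPoisedSum b q p - wellPoisedSum b 0 p) ∈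
      padicPow p 3 := by
  simp only [wellPoisedSum, ← Finset.sum_sub_distrib]
  exact sum_mem fun k hk =>
    (incrementCongr_wellPoisedTerm ha hb hab hq (Finset.mem_range.mp hk)).incr

theorem wellPoisedSum_sub_mem {a b q : ℚ_[p]} (ha : a ∈ padicPow p 0)
    (hb : b ∈ padicPow p 0) (hab : a - b ∈ padicPow p 1) (hq : q ∈ padicPow p 2) :
    wellPoisedSum a q p - wellPoisedSum b q p ∈ padicPow p 1 := by
  simp only [wellPoisedSum, ← Finset.sum_sub_distrib]
  refine sum_mem fun k hk => ?_
  have h := incrementCongr_wellPoisedTerm ha hb hab hq (Finset.mem_range.mp hk)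
  have := add_mem h.base (padicPow_mono (by norm_num : 1 ≤ 3) h.incr)
  convert this using 1
  ring

theorem incrementCongr_sq_sub_div {x y q : ℚ_[p]} (hx : ‖x‖ = 1) (hy : ‖y‖ = 1)
    (h : x - y ∈ padicPow p 1) (hq : q ∈ padicPow p 2) :
    IncrementCongr ((x ^ 2 - q) / x ^ 2) ((y ^ 2 - q) / y ^ 2) 1 1 := by
  have hx0 : x ≠ 0 := norm_ne_zero_iff.mp (by rw [hx]; exact one_ne_zero)
  have hy0 : y ≠ 0 := norm_ne_zero_iff.mp (by rw [hy]; exact one_ne_zero)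
  have ex : (x ^ 2 - q) / x ^ 2 - 1 = -q * (x⁻¹) ^ 2 := by field_simp; ring
  have ey : (y ^ 2 - q) / y ^ 2 - 1 = -q * (y⁻¹) ^ 2 := by field_simp; ring
  have ix := inv_mem_padicPow_zero hx
  have iy := inv_mem_padicPow_zero hy
  refine ⟨one_mem_padicPow_zero, one_mem_padicPow_zero, by simp [zero_mem], ?_, ?_, ?_⟩
  · rw [ex]; exact mul_mem_padicPow_left (neg_mem hq) (sq_mem_padicPow_zero ix)
  · rw [ey]; exact mul_mem_padicPow_left (neg_mem hq) (sq_mem_padicPow_zero iy)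
  · rw [ex, ey, ← mul_sub]
    exact mul_mem_padicPow (neg_mem hq) (sq_sub_sq_mem ix iy (inv_sub_inv_mem hx hy h))

theorem truncHypergeom_eq_wellPoisedSum (a : ℚ_[p]) :
    truncHypergeom [a, a, a] [1, 1] 1 (p - 1) = wellPoisedSum a 0 p := by
  rw [truncHypergeom, Nat.sub_add_cancel (Fact.out : p.Prime).one_le, wellPoisedSum]
  refine Finset.sum_congr rfl fun k hkp => ?_
  have hk : (k.factorial : ℚ_[p]) ≠ 0 := by exact_mod_cast k.factorial_ne_zero
  have h1 : (ascPochhammer ℚ_[p] k).eval 1 = k.factorial := by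
    simp
  have h2 : (∏ j ∈ Finset.range k, ((j : ℚ_[p]) + 1)) = k.factorial := by
    rw [← Finset.prod_range_add_one_eq_factorial]; push_cast; rfl
  have h3 : wellPoisedTerm a 0 k =
      (∏ j ∈ Finset.range k, (a + j)) ^ 3 / (∏ j ∈ Finset.range k, ((j : ℚ_[p]) + 1)) ^ 3 := by
    rw [wellPoisedTerm, ← Finset.prod_pow, ← Finset.prod_pow, ← Finset.prod_div_distrib]
    refine Finset.prod_congr rfl fun j _ => ?_
    congr 1 <;> ring
  have h4 : (ascPochhammer ℚ_[p] k).eval a = ∏ j ∈ Finset.range k, (a + j) := by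
    clear h1 h2 h3 hk
    induction k with
    | zero => simp
    | succ k ih => rw [ascPochhammer_succ_eval, ih (by simp only [Finset.mem_range] at *; omega), Finset.prod_range_succ]
  rw [h3, h2]
  simp only [List.map_cons, List.map_nil, List.prod_cons, List.prod_nil, h1, one_pow, mul_one, h4]
  field_simp

end

section
variable {p : ℕ} [Fact p.Prime]

theorem PadicInt.not_dvd_natCast_add {j : ℕ} (h0 : 0 < j) (hj : j < p) {x : ℤ_[p]}
    (hx : (p : ℤ_[p]) ∣ x) : ¬ (p : ℤ_[p]) ∣ (j : ℤ_[p]) + x := by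
  intro h
  have := (dvd_add_left hx).mp h
  rw [PadicInt.natCast_dvd_natCast] at this
  exact Nat.not_dvd_of_pos_of_lt h0 hj this

theorem prod_unitPart_eq {m : ℕ} (hm : m < p) {x : ℤ_[p]} (hx : (p : ℤ_[p]) ∣ x) :
    ∏ j ∈ Finset.range m, unitPart p (1 + x + j) = ∏ j ∈ Finset.range m, ((j : ℤ_[p]) + 1 + x) := by
  refine Finset.prod_congr rfl fun j hj => ?_
  have hj := Finset.mem_range.mp hj
  have := PadicInt.not_dvd_natCast_add (p := p) (Nat.succ_pos j) (by omega) hx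
  push_cast at this
  rw [show 1 + x + (j : ℤ_[p]) = j + 1 + x by ring, unitPart_of_not_dvd this]

theorem padicGamma_one_add_of_dvd (hp : Odd p) {x : ℤ_[p]} (hx : (p : ℤ_[p]) ∣ x) :
    padicGamma p (1 + x) = -padicGamma p x := by
  rw [add_comm, padicGamma_add_one hp, unitPart_of_dvd hx, neg_one_mul]

theorem padicGamma_one_add_natCast_add (hp : Odd p) {m : ℕ} (hm : m < p) {x : ℤ_[p]}
    (hx : (p : ℤ_[p]) ∣ x) : padicGamma p (1 + m + x) =
      (-1) ^ (m + 1) * (∏ j ∈ Finset.range m, ((j : ℤ_[p]) + 1 + x)) * padicGamma p x := by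
  rw [show 1 + (m : ℤ_[p]) + x = 1 + x + m by ring, padicGamma_add_natCast hp,
    prod_unitPart_eq hm hx, padicGamma_one_add_of_dvd hp hx]
  ring

/-- `(x + 1) ⋯ (x + p - 1)`. -/
noncomputable def blockProd (p : ℕ) [Fact p.Prime] (x : ℤ_[p]) : ℤ_[p] :=
  ∏ j ∈ Finset.range (p - 1), ((j : ℤ_[p]) + 1 + x)

theorem padicGamma_add_prime (hp : Odd p) {x : ℤ_[p]} (hx : (p : ℤ_[p]) ∣ x) :
    padicGamma p (x + p) = -blockProd p x * padicGamma p x := by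
  have h1 := (Fact.out : p.Prime).one_le
  have h := padicGamma_one_add_natCast_add hp (m := p - 1) (by omega) hx
  rw [Nat.sub_add_cancel h1, hp.neg_one_pow, Nat.cast_sub h1] at h
  rw [show x + (p : ℤ_[p]) = 1 + ((p : ℤ_[p]) - (1 : ℕ)) + x by push_cast; ring, h, blockProd]
  ring

theorem blockProd_reflect (x : ℤ_[p]) :
    blockProd p x = ∏ j ∈ Finset.range (p - 1), (x + p - ((j : ℤ_[p]) + 1)) := by
  rw [blockProd, ← Finset.prod_range_reflect]
  refine Finset.prod_congr rfl fun j hj => ?_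
  have hj := Finset.mem_range.mp hj
  have : ((p - 1 - 1 - j : ℕ) : ℤ_[p]) + (j + 2) = p := by
    exact_mod_cast (by omega : p - 1 - 1 - j + (j + 2) = p)
  linear_combination this

theorem blockProd_neg (hp : Odd p) (x : ℤ_[p]) : blockProd p (-(x + p)) = blockProd p x := by
  rw [blockProd_reflect]
  rw [show ∏ j ∈ Finset.range (p - 1), (-(x + p) + (p : ℤ_[p]) - ((j : ℤ_[p]) + 1)) =
    ∏ j ∈ Finset.range (p - 1), -((j : ℤ_[p]) + 1 + x) from
      Finset.prod_congr rfl fun j _ => by ring]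
  rw [Finset.prod_neg, Finset.card_range, (Nat.Odd.sub_odd hp odd_one).neg_one_pow, one_mul,
    blockProd]

theorem not_dvd_blockProd {x : ℤ_[p]} (hx : (p : ℤ_[p]) ∣ x) : ¬ (p : ℤ_[p]) ∣ blockProd p x := by
  rw [blockProd, Prime.dvd_finsetProd_iff PadicInt.prime_p]
  rintro ⟨j, hj, h⟩
  have hj := Finset.mem_range.mp hj
  refine PadicInt.not_dvd_natCast_add (p := p) (Nat.succ_pos j) (by omega) hx ?_
  exact_mod_cast h

theorem padicGamma_mul_padicGamma_neg (hp : Odd p) (z : ℕ) :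
    padicGamma p (p * z) * padicGamma p (-(p * z)) = 1 := by
  induction z with
  | zero => simp [padicGamma_zero hp]
  | succ z ih =>
    have h1 := padicGamma_add_prime hp (x := p * (z : ℤ_[p])) (dvd_mul_right _ _)
    have h2 := padicGamma_add_prime hp (x := -(p * (z : ℤ_[p]) + p))
      (dvd_neg.mpr (dvd_add (dvd_mul_right _ _) dvd_rfl))
    rw [blockProd_neg hp, show -(p * (z : ℤ_[p]) + p) + p = -(p * z) by ring] at h2
    rw [show (p : ℤ_[p]) * ((z + 1 : ℕ) : ℤ_[p]) = p * z + p by push_cast; ring, h1]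
    rw [← ih, h2]
    ring

/-- Reflection formula at `p z - n`. -/
theorem padicGamma_reflection (hp : Odd p) (z n : ℕ) (hn0 : 0 < n) (hn : n < p) {x : ℤ_[p]}
    (hx : x + n = p * z) :
    padicGamma p (1 + x) * padicGamma p (1 - x) = (-1) ^ n * x := by
  have hd : (p : ℤ_[p]) ∣ -(p * (z : ℤ_[p])) := dvd_neg.mpr (dvd_mul_right _ _)
  have h1 := padicGamma_one_add_natCast_add hp hn hd
  rw [show 1 + (n : ℤ_[p]) + -(p * (z : ℤ_[p])) = 1 - x by linear_combination hx] at h1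
  have h2 := padicGamma_add_natCast hp x n
  have hu : ∏ j ∈ Finset.range n, unitPart p (x + j) =
      (-1) ^ n * ∏ j ∈ Finset.range n, ((j : ℤ_[p]) + 1 + -(p * (z : ℤ_[p]))) := by
    have hneg := Finset.prod_neg (s := Finset.range n)
      (fun j : ℕ => (j : ℤ_[p]) + 1 + -(p * (z : ℤ_[p])))
    rw [Finset.card_range] at hneg
    rw [← Finset.prod_range_reflect, ← hneg]
    refine Finset.prod_congr rfl fun j hj => ?_
    have hj := Finset.mem_range.mp hj
    have hc : ((n - 1 - j : ℕ) : ℤ_[p]) + 1 + j = n := by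
      exact_mod_cast (by omega : n - 1 - j + 1 + j = n)
    have e : x + ((n - 1 - j : ℕ) : ℤ_[p]) = -(((j + 1 : ℕ) : ℤ_[p]) + -(p * (z : ℤ_[p]))) := by
      push_cast
      linear_combination hx + hc
    rw [e, unitPart_of_not_dvd]
    · push_cast; ring
    · rw [dvd_neg]
      exact PadicInt.not_dvd_natCast_add (Nat.succ_pos j) (by omega) hd
  rw [hu, hx] at h2
  have hxu : ¬ (p : ℤ_[p]) ∣ x := by
    intro h
    have h' : (p : ℤ_[p]) ∣ (n : ℤ_[p]) + x := by rw [add_comm, hx]; exact dvd_mul_right _ _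
    rw [dvd_add_left h, PadicInt.natCast_dvd_natCast] at h'
    exact Nat.not_dvd_of_pos_of_lt hn0 hn h'
  have h3 : padicGamma p (1 + x) = -x * padicGamma p x := by
    rw [add_comm, padicGamma_add_one hp, unitPart_of_not_dvd hxu]
  have h4 := padicGamma_mul_padicGamma_neg hp z
  have hs : ((-1 : ℤ_[p]) ^ n) * (-1) ^ n = 1 := by
    rw [← pow_add, (Even.add_self n).neg_one_pow]
  rw [h3, h1]
  rw [h2] at h4
  linear_combination (-1) ^ n * x * h4 - (-1) ^ n * x * hs *
    (∏ j ∈ Finset.range n, ((j : ℤ_[p]) + 1 + -(p * (z : ℤ_[p])))) * padicGamma p x *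
      padicGamma p (-(p * z))

theorem sq_dvd_prod_one_add_mul {R : Type*} [CommRing R] (y : R) (c : ℕ → R) (k : ℕ) :
    y ^ 2 ∣ ∏ j ∈ Finset.range k, (1 + c j * y) - 1 - y * ∑ j ∈ Finset.range k, c j := by
  induction k with
  | zero => simp
  | succ k ih =>
    obtain ⟨d, hd⟩ := ih
    rw [Finset.prod_range_succ, Finset.sum_range_succ]
    refine ⟨d * (1 + c k * y) + c k * ∑ j ∈ Finset.range k, c j, ?_⟩
    linear_combination (1 + c k * y) * hd

theorem PadicInt.toZMod_eq_zero_iff_dvd (x : ℤ_[p]) : PadicInt.toZMod x = 0 ↔ (p : ℤ_[p]) ∣ x := by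
  rw [← RingHom.mem_ker, PadicInt.ker_toZMod, PadicInt.maximalIdeal_eq_span_p,
    Ideal.mem_span_singleton]

theorem ZMod.sum_inv_sq (h5 : 5 ≤ p) :
    ∑ j ∈ Finset.range (p - 1), (((j : ZMod p) + 1)⁻¹) ^ 2 = 0 := by
  have h1 : ∑ x : ZMod p, (x⁻¹) ^ 2 = 0 := by
    have h := Equiv.sum_comp (Equiv.inv (ZMod p)) (fun x => x ^ 2)
    simp only [Equiv.inv_apply] at h
    rw [h]
    apply FiniteField.sum_pow_lt_card_sub_one
    rw [ZMod.card]
    omega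
  have h2 : ∑ x : ZMod p, (x⁻¹) ^ 2 = ∑ k ∈ Finset.range p, ((k : ZMod p)⁻¹) ^ 2 :=
    ZMod.sum_univ_eq_sum_range p fun x => (x⁻¹ : ZMod p) ^ 2
  have h3 := Finset.sum_range_succ' (fun k : ℕ => ((k : ZMod p)⁻¹) ^ 2) (p - 1)
  rw [Nat.sub_add_cancel (by omega), ← h2, h1] at h3
  simpa using h3.symm

theorem blockProd_sq (z : ℤ_[p]) : blockProd p (p * z) ^ 2 =
    ∏ j ∈ Finset.range (p - 1),
      (((j : ℤ_[p]) + 1) * (p - (j + 1)) + (p : ℤ_[p]) ^ 2 * (z * (z + 1))) := by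
  rw [pow_two]
  nth_rewrite 2 [blockProd_reflect]
  rw [blockProd, ← Finset.prod_mul_distrib]
  exact Finset.prod_congr rfl fun j _ => by ring

theorem pow_dvd_blockProd_sub {e : ℕ} (hp : Odd p) (z : ℤ_[p])
    (h : (p : ℤ_[p]) ^ e ∣ blockProd p (p * z) ^ 2 - blockProd p 0 ^ 2) :
    (p : ℤ_[p]) ^ e ∣ blockProd p (p * z) - blockProd p 0 := by
  have hd : ∀ k : ℕ, (p : ℤ_[p]) ∣ ∏ j ∈ Finset.range k, ((j : ℤ_[p]) + 1 + p * z) -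
      ∏ j ∈ Finset.range k, ((j : ℤ_[p]) + 1 + 0) := by
    intro k
    induction k with
    | zero => simp
    | succ k ih =>
      obtain ⟨d, hd⟩ := ih
      rw [Finset.prod_range_succ, Finset.prod_range_succ]
      refine ⟨d * (k + 1) + (∏ j ∈ Finset.range k, ((j : ℤ_[p]) + 1 + p * z)) * z, ?_⟩
      linear_combination (k + 1) * hd
  have hd' : (p : ℤ_[p]) ∣ blockProd p (p * z) - blockProd p 0 := hd _
  rw [sq_sub_sq] at h
  refine PadicInt.prime_p.pow_dvd_of_dvd_mul_left e (fun hs => ?_) h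
  have h2 : (p : ℤ_[p]) ∣ (2 : ℕ) * blockProd p 0 := by
    have := dvd_sub hs hd'
    convert this using 1
    push_cast
    ring
  rcases PadicInt.prime_p.dvd_or_dvd h2 with h2 | h2
  · rw [PadicInt.natCast_dvd_natCast] at h2
    have := (Nat.prime_dvd_prime_iff_eq Fact.out Nat.prime_two).mp h2
    subst this
    exact absurd hp (by decide)
  · exact not_dvd_blockProd (dvd_zero _) h2

theorem blockProd_congr (hp : Odd p) {e : ℕ} (he : e ≤ 2 ∨ e ≤ 3 ∧ 5 ≤ p) (z : ℤ_[p]) :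
    (p : ℤ_[p]) ^ e ∣ blockProd p (p * z) - blockProd p 0 := by
  apply pow_dvd_blockProd_sub hp
  have hu : ∀ j : ℕ, ∃ c : ℤ_[p], j < p - 1 → ((j : ℤ_[p]) + 1) * (p - (j + 1)) * c = 1 := by
    intro j
    by_cases hj : j < p - 1
    · have : IsUnit (((j : ℤ_[p]) + 1) * (p - (j + 1))) := by
        rw [PadicInt.isUnit_iff_not_dvd]
        intro h
        have hn : ¬ (p : ℤ_[p]) ∣ (j : ℤ_[p]) + 1 := by
          simpa using PadicInt.not_dvd_natCast_add (p := p) (Nat.succ_pos j) (by omega) (dvd_zero _)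
        rcases PadicInt.prime_p.dvd_or_dvd h with h | h
        · exact hn h
        · exact hn ((dvd_sub_right dvd_rfl).mp h)
      obtain ⟨c, hc⟩ := this.exists_right_inv
      exact ⟨c, fun _ => hc⟩
    · exact ⟨0, fun h => absurd h hj⟩
  choose c hc using hu
  set u : ℕ → ℤ_[p] := fun j => ((j : ℤ_[p]) + 1) * (p - (j + 1)) with hudef
  set y : ℤ_[p] := (p : ℤ_[p]) ^ 2 * (z * (z + 1)) with hy
  have e1 : blockProd p (p * z) ^ 2 =
      (∏ j ∈ Finset.range (p - 1), u j) * ∏ j ∈ Finset.range (p - 1), (1 + c j * y) := by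
    rw [blockProd_sq, ← Finset.prod_mul_distrib]
    refine Finset.prod_congr rfl fun j hj => ?_
    have := hc j (Finset.mem_range.mp hj)
    linear_combination (-y) * this
  have e0 : blockProd p 0 ^ 2 = ∏ j ∈ Finset.range (p - 1), u j := by
    have := blockProd_sq (p := p) 0
    simpa using this
  rw [e1, e0]
  obtain ⟨d, hd⟩ := sq_dvd_prod_one_add_mul y c (p - 1)
  have hyd : (p : ℤ_[p]) ^ 2 ∣ y := dvd_mul_right _ _
  have hsum : (p : ℤ_[p]) ^ e ∣ y * ∑ j ∈ Finset.range (p - 1), c j := by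
    rcases he with he | ⟨he, h5⟩
    · exact dvd_mul_of_dvd_left ((pow_dvd_pow _ he).trans hyd) _
    · refine (pow_dvd_pow _ he).trans ?_
      rw [pow_succ]
      refine mul_dvd_mul hyd ?_
      rw [← PadicInt.toZMod_eq_zero_iff_dvd, map_sum, ← neg_zero, ← ZMod.sum_inv_sq h5,
        ← Finset.sum_neg_distrib]
      refine Finset.sum_congr rfl fun j hj => ?_
      have := congrArg PadicInt.toZMod (hc j (Finset.mem_range.mp hj))
      simp only [map_mul, map_add, map_sub, map_natCast, map_one, CharP.cast_eq_zero,
        zero_sub] at this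
      have h0 : ((j : ZMod p) + 1) ≠ 0 := by
        intro h; rw [h] at this; simp at this
      field_simp
      linear_combination -this
  have hsq : (p : ℤ_[p]) ^ e ∣ y ^ 2 * d := by
    refine dvd_mul_of_dvd_left ((pow_dvd_pow _ (by omega : e ≤ 4)).trans ?_) _
    rw [show 4 = 2 * 2 by norm_num, pow_mul]
    exact pow_dvd_pow_of_dvd hyd 2
  have : (∏ j ∈ Finset.range (p - 1), u j) * ∏ j ∈ Finset.range (p - 1), (1 + c j * y) -
      ∏ j ∈ Finset.range (p - 1), u j = (∏ j ∈ Finset.range (p - 1), u j) *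
        (y * (∑ j ∈ Finset.range (p - 1), c j) + y ^ 2 * d) := by
    linear_combination (∏ j ∈ Finset.range (p - 1), u j) * hd
  rw [this]
  exact dvd_mul_of_dvd_right (dvd_add hsum hsq) _

theorem padicGamma_prime_mul_congr (hp : Odd p) {e : ℕ} (he : e ≤ 2 ∨ e ≤ 3 ∧ 5 ≤ p)
    (y : ℤ_[p]) (t : ℕ) : (p : ℤ_[p]) ^ e ∣
      padicGamma p (p * (y - t)) * padicGamma p (p * (y + t)) - padicGamma p (p * y) ^ 2 := by
  have hstep : ∀ x : ℤ_[p], ∀ t : ℕ, (p : ℤ_[p]) ^ e ∣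
      padicGamma p (p * (x + t)) - (-blockProd p 0) ^ t * padicGamma p (p * x) := by
    intro x t
    induction t with
    | zero => simp
    | succ t ih =>
      have h1 := padicGamma_add_prime hp (x := p * (x + (t : ℤ_[p]))) (dvd_mul_right _ _)
      rw [show (p : ℤ_[p]) * (x + ((t + 1 : ℕ) : ℤ_[p])) = p * (x + t) + p by push_cast; ring, h1]
      have h2 := blockProd_congr hp he (x + (t : ℤ_[p]))
      have := dvd_sub (dvd_mul_of_dvd_right ih (-blockProd p 0))
        (dvd_mul_of_dvd_left h2 (padicGamma p (p * (x + t))))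
      convert this using 1
      ring
  have h1 := hstep y t
  have h2 := hstep (y - t) t
  rw [sub_add_cancel] at h2
  have := dvd_sub (dvd_mul_of_dvd_right h1 (padicGamma p (p * (y - t))))
    (dvd_mul_of_dvd_right h2 (padicGamma p (p * y)))
  convert this using 1
  ring

end

section
variable {p : ℕ} [Fact p.Prime]

theorem PadicInt.coe_finsetProd (s : Finset ℕ) (f : ℕ → ℤ_[p]) :
    ((∏ j ∈ s, f j : ℤ_[p]) : ℚ_[p]) = ∏ j ∈ s, (f j : ℚ_[p]) :=
  map_prod PadicInt.Coe.ringHom f s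

theorem padicGamma_norm (hp : Odd p) (x : ℤ_[p]) : ‖(padicGamma p x : ℚ_[p])‖ = 1 := by
  rw [← PadicInt.norm_def]
  exact PadicInt.isUnit_iff.mp (isUnit_padicGamma hp x)

theorem padicGamma_coe_ne_zero (hp : Odd p) (x : ℤ_[p]) : (padicGamma p x : ℚ_[p]) ≠ 0 :=
  norm_ne_zero_iff.mp (by rw [padicGamma_norm hp]; exact one_ne_zero)

theorem norm_natCast_add_one_add {j : ℕ} (hj : j + 1 < p) {x : ℚ_[p]} (hx : x ∈ padicPow p 1) :
    ‖(j : ℚ_[p]) + 1 + x‖ = 1 := by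
  refine norm_eq_one_of_sub_mem (y := ((j + 1 : ℕ) : ℚ_[p]))
    (norm_natCast_of_lt (Nat.succ_pos j) hj) ?_
  push_cast
  rwa [add_sub_cancel_left]

theorem prime_mul_mem_padicPow_one (x : ℤ_[p]) : (p : ℚ_[p]) * x ∈ padicPow p 1 :=
  mul_mem_padicPow prime_mem_padicPow_one (coe_mem_padicPow_zero x)

/-- The quotient `Γ_p(v - pt) Γ_p(v + pt) / Γ_p(v)²`. -/
noncomputable def gammaSecondRatio (p : ℕ) [Fact p.Prime] (v : ℤ_[p]) (t : ℕ) : ℚ_[p] :=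
  (padicGamma p (v - p * t) : ℚ_[p]) * (padicGamma p (v + p * t) : ℚ_[p]) /
    (padicGamma p v : ℚ_[p]) ^ 2

theorem gammaSecondRatio_eq (hp : Odd p) {m : ℕ} (hm : m < p) (y : ℤ_[p]) (t : ℕ) :
    gammaSecondRatio p (1 + m + p * y) t =
      (∏ j ∈ Finset.range m, (((j : ℚ_[p]) + 1 + p * y) ^ 2 - ((p : ℚ_[p]) * t) ^ 2) /
        ((j : ℚ_[p]) + 1 + p * y) ^ 2) *
      ((padicGamma p (p * (y - t)) : ℚ_[p]) * (padicGamma p (p * (y + t)) : ℚ_[p]) /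
        (padicGamma p (p * y) : ℚ_[p]) ^ 2) := by
  rw [gammaSecondRatio, show 1 + (m : ℤ_[p]) + p * y - p * t = 1 + m + p * (y - t) by ring,
    show 1 + (m : ℤ_[p]) + p * y + p * t = 1 + m + p * (y + t) by ring,
    padicGamma_one_add_natCast_add hp hm (dvd_mul_right _ _),
    padicGamma_one_add_natCast_add hp hm (dvd_mul_right _ _),
    padicGamma_one_add_natCast_add hp hm (dvd_mul_right _ _)]
  have hs : ((-1 : ℚ_[p]) ^ (m + 1)) ^ 2 = 1 := by
    rw [← pow_mul, mul_comm, pow_mul]; simp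
  have hN : ∏ j ∈ Finset.range m, (((j : ℚ_[p]) + 1 + p * y) ^ 2 - ((p : ℚ_[p]) * t) ^ 2) =
      (∏ j ∈ Finset.range m, ((j : ℚ_[p]) + 1 + p * (y - t))) *
        ∏ j ∈ Finset.range m, ((j : ℚ_[p]) + 1 + p * (y + t)) := by
    rw [← Finset.prod_mul_distrib]
    exact Finset.prod_congr rfl fun j _ => by ring
  rw [Finset.prod_div_distrib, hN, Finset.prod_pow, div_mul_div_comm]
  push_cast
  simp only [PadicInt.coe_finsetProd]
  push_cast
  rw [mul_pow, mul_pow, hs, one_mul]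
  congr 1
  linear_combination (∏ j ∈ Finset.range m, ((j : ℚ_[p]) + 1 + p * (y - t))) *
    (∏ j ∈ Finset.range m, ((j : ℚ_[p]) + 1 + p * (y + t))) *
    (padicGamma p (p * (y - t)) : ℚ_[p]) * (padicGamma p (p * (y + t)) : ℚ_[p]) * hs

theorem natCast_prime_mul_sq_mem (t : ℕ) : ((p : ℚ_[p]) * t) ^ 2 ∈ padicPow p 2 := by
  have := mul_mem_padicPow prime_mem_padicPow_one (natCast_mem_padicPow_zero (p := p) t)
  rw [pow_two]
  exact mul_mem_padicPow this this

theorem incrementCongr_gammaSecondRatio {m : ℕ} (hm : m < p) (y : ℤ_[p]) (t : ℕ) :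
    IncrementCongr (p := p)
      (∏ j ∈ Finset.range m, (((j : ℚ_[p]) + 1 + p * y) ^ 2 - ((p : ℚ_[p]) * t) ^ 2) /
        ((j : ℚ_[p]) + 1 + p * y) ^ 2)
      (∏ j ∈ Finset.range m, (((j : ℚ_[p]) + 1) ^ 2 - ((p : ℚ_[p]) * t) ^ 2) /
        ((j : ℚ_[p]) + 1) ^ 2)
      1 1 := by
  have := IncrementCongr.prod (p := p)
    (f := fun j => (((j : ℚ_[p]) + 1 + p * y) ^ 2 - ((p : ℚ_[p]) * t) ^ 2) / ((j : ℚ_[p]) + 1 + p * y) ^ 2)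
    (f' := fun j => (((j : ℚ_[p]) + 1) ^ 2 - ((p : ℚ_[p]) * t) ^ 2) / ((j : ℚ_[p]) + 1) ^ 2)
    (g := fun _ => 1) (g' := fun _ => 1) m (fun j hj => by
      refine incrementCongr_sq_sub_div
        (norm_natCast_add_one_add (by omega) (prime_mul_mem_padicPow_one y)) ?_ ?_
        (natCast_prime_mul_sq_mem t)
      · simpa using norm_natCast_add_one_add (p := p) (j := j) (by omega) (zero_mem _)
      · rw [add_sub_cancel_left]; exact prime_mul_mem_padicPow_one y)
  simpa using this

theorem gammaSecondRatio_factor_sub_one (hp : Odd p) {e : ℕ} (he : e ≤ 2 ∨ e ≤ 3 ∧ 5 ≤ p)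
    (y : ℤ_[p]) (t : ℕ) :
    (padicGamma p (p * (y - t)) : ℚ_[p]) * (padicGamma p (p * (y + t)) : ℚ_[p]) /
        (padicGamma p (p * y) : ℚ_[p]) ^ 2 - 1 ∈ padicPow p e := by
  have h := coe_mem_padicPow_iff.mpr (padicGamma_prime_mul_congr hp he y t)
  have hn := padicGamma_norm hp (p * y)
  have h0 := padicGamma_coe_ne_zero hp (p * y)
  push_cast at h
  rw [div_sub_one (pow_ne_zero 2 h0), div_eq_mul_inv]
  exact mul_mem_padicPow_left h (inv_mem_padicPow_zero (by rw [norm_pow, hn, one_pow]))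

theorem gammaSecondRatio_sub_one_mem (hp : Odd p) {m : ℕ} (hm : m < p) (y : ℤ_[p]) (t : ℕ) :
    gammaSecondRatio p (1 + m + p * y) t - 1 ∈ padicPow p 2 := by
  rw [gammaSecondRatio_eq hp hm]
  have h1 := (incrementCongr_gammaSecondRatio hm y t).left_incr
  have h2 := gammaSecondRatio_factor_sub_one hp (e := 2) (Or.inl le_rfl) y t
  have := mul_sub_mul_mem (r := 2) (x' := 1) (y' := 1)
    (by simpa using add_mem (padicPow_mono (Nat.zero_le 2) h1) one_mem_padicPow_zero)
    one_mem_padicPow_zero h1 h2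
  simpa using this

theorem gammaSecondRatio_sub_prod_mem (hp : Odd p) (h5 : 5 ≤ p) {m : ℕ} (hm : m < p)
    (y : ℤ_[p]) (t : ℕ) : gammaSecondRatio p (1 + m + p * y) t -
      ∏ j ∈ Finset.range m, (((j : ℚ_[p]) + 1) ^ 2 - ((p : ℚ_[p]) * t) ^ 2) / ((j : ℚ_[p]) + 1) ^ 2 ∈
        padicPow p 3 := by
  rw [gammaSecondRatio_eq hp hm]
  have h := incrementCongr_gammaSecondRatio hm y t
  have h2 := gammaSecondRatio_factor_sub_one hp (e := 3) (Or.inr ⟨le_rfl, h5⟩) y t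
  have := mul_sub_mul_mem (r := 3) (y' := 1)
    (by simpa using add_mem (padicPow_mono (Nat.zero_le 2) h.left_incr) one_mem_padicPow_zero)
    one_mem_padicPow_zero (by simpa using h.incr) h2
  simpa using this

/-- Among `n ≤ p` consecutive elements only `x + i` can be divisible by `p`. -/
theorem prod_add_eq_mul_prod_unitPart {x : ℤ_[p]} {i n : ℕ} (hi : i < p) (hn : n ≤ p)
    (hx : (p : ℤ_[p]) ∣ x + i) :
    ∏ j ∈ Finset.range n, (x + j) =
      (if i < n then x + i else 1) * ∏ j ∈ Finset.range n, unitPart p (x + j) := by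
  have huniq : ∀ j < p, j ≠ i → ¬ (p : ℤ_[p]) ∣ x + j := by
    intro j hj hne h
    have hd := dvd_sub h hx
    rw [add_sub_add_left_eq_sub] at hd
    have hd' : (p : ℤ) ∣ (j : ℤ) - i := by
      have := (PadicInt.pow_p_dvd_int_iff (p := p) 1 ((j : ℤ) - i)).mp (by push_cast; simpa using hd)
      simpa using this
    obtain ⟨c, hc⟩ := hd'
    have h1 : c < 1 := by
      by_contra hcon
      have : (p : ℤ) * 1 ≤ p * c := mul_le_mul_of_nonneg_left (by omega) (by omega)
      omega
    have h2 : -1 < c := by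
      by_contra hcon
      have : (p : ℤ) * c ≤ p * (-1) := mul_le_mul_of_nonneg_left (by omega) (by omega)
      omega
    obtain rfl : c = 0 := by omega
    omega
  split_ifs with h
  · rw [← Finset.mul_prod_erase _ _ (Finset.mem_range.mpr h),
      ← Finset.mul_prod_erase (Finset.range n) (fun j : ℕ => unitPart p (x + j))
        (Finset.mem_range.mpr h), unitPart_of_dvd hx, one_mul]
    congr 1
    refine Finset.prod_congr rfl fun j hj => ?_
    have hj' := Finset.mem_range.mp (Finset.mem_of_mem_erase hj)
    rw [unitPart_of_not_dvd (huniq j (by omega) (Finset.ne_of_mem_erase hj))]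
  · rw [one_mul]
    refine Finset.prod_congr rfl fun j hj => ?_
    have hj' := Finset.mem_range.mp hj
    rw [unitPart_of_not_dvd (huniq j (by omega) (by omega))]

theorem two_mul_padicHalf (hp : Odd p) : (2 : ℤ_[p]) * padicHalf p = 1 := by
  refine PadicInt.mul_inv ?_
  have h : ¬ (p : ℤ_[p]) ∣ ((2 : ℕ) : ℤ_[p]) := by
    rw [PadicInt.natCast_dvd_natCast]
    intro h2
    have := (Nat.prime_dvd_prime_iff_eq Fact.out Nat.prime_two).mp h2
    subst this
    exact absurd hp (by decide)
  exact_mod_cast PadicInt.isUnit_iff.mp (PadicInt.isUnit_iff_not_dvd.mpr h)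

theorem dixonG_two_mul (hp : Odd p) (h : ℤ_[p]) : dixonG p (2 * h) =
    ((padicGamma p (1 + h) : ℚ_[p]) * (padicGamma p (1 - 3 * h) : ℚ_[p])) /
      ((padicGamma p (1 + 2 * h) : ℚ_[p]) * (padicGamma p (1 - 2 * h) : ℚ_[p]) *
        (padicGamma p (1 - h) : ℚ_[p]) ^ 2) := by
  have h2 := two_mul_padicHalf hp
  rw [dixonG, show padicHalf p * (2 * h) = h by linear_combination h * h2,
    show 3 * padicHalf p * (2 * h) = 3 * h by linear_combination 3 * h * h2]

/-- The unit part of the closed form of the terminating series. -/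
noncomputable def unitQuotient (p : ℕ) [Fact p.Prime] (h : ℤ_[p]) (n : ℕ) : ℚ_[p] :=
  (-1) ^ n / (2 * h) *
    ((∏ j ∈ Finset.range n, unitPart p (1 - 3 * h - n + j) : ℤ_[p]) : ℚ_[p]) /
      ((∏ j ∈ Finset.range n, unitPart p (1 + h + j) : ℤ_[p]) : ℚ_[p])

theorem prod_unitPart_norm (x : ℤ_[p]) (n : ℕ) :
    ‖((∏ j ∈ Finset.range n, unitPart p (x + j) : ℤ_[p]) : ℚ_[p])‖ = 1 := by
  rw [← PadicInt.norm_def]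
  exact PadicInt.isUnit_iff.mp (Finset.prod_induction _ IsUnit (fun _ _ => IsUnit.mul) isUnit_one
    (fun k _ => isUnit_unitPart _))

theorem dixonG_eq_mul (hp : Odd p) {n t : ℕ} (hn0 : 0 < n) (hn : n < p) {h : ℤ_[p]}
    (hh : 2 * h + n = p * t) :
    dixonG p (2 * h) = gammaSecondRatio p (1 - h) t * unitQuotient p h n := by
  have hr := padicGamma_reflection hp t n hn0 hn hh
  have h1 := padicGamma_add_natCast hp (1 + h) n
  have h2 := padicGamma_add_natCast hp (1 - 3 * h - n) n
  rw [sub_add_cancel] at h2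
  rw [dixonG_two_mul hp, gammaSecondRatio, unitQuotient,
    show 1 - h - p * t = 1 - 3 * h - (n : ℤ_[p]) by linear_combination hh,
    show 1 - h + p * t = 1 + h + (n : ℤ_[p]) by linear_combination -hh]
  have hr' : (padicGamma p (1 + 2 * h) : ℚ_[p]) * (padicGamma p (1 - 2 * h) : ℚ_[p]) =
      (-1) ^ n * (2 * h) := by
    have := congrArg (fun x : ℤ_[p] => (x : ℚ_[p])) hr
    push_cast at this
    exact this
  rw [hr', h1, h2]
  have e1 := padicGamma_coe_ne_zero hp (1 - h)
  have e2 : ((∏ j ∈ Finset.range n, unitPart p (1 + h + j) : ℤ_[p]) : ℚ_[p]) ≠ 0 :=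
    norm_ne_zero_iff.mp (by rw [prod_unitPart_norm]; exact one_ne_zero)
  have e3 : (2 * h : ℚ_[p]) ≠ 0 := by
    intro h0
    rw [h0, mul_zero] at hr'
    exact (mul_ne_zero (padicGamma_coe_ne_zero hp _) (padicGamma_coe_ne_zero hp _)) hr'
  have hs : ((-1 : ℚ_[p]) ^ n) * (-1) ^ n = 1 := by
    rw [← pow_add, (Even.add_self n).neg_one_pow]
  have hs0 : ((-1 : ℚ_[p]) ^ n) ≠ 0 := left_ne_zero_of_mul_eq_one hs
  rw [PadicInt.coe_mul, PadicInt.coe_mul, PadicInt.coe_mul, PadicInt.coe_mul]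
  generalize ((∏ j ∈ Finset.range n, unitPart p (1 + h + j) : ℤ_[p]) : ℚ_[p]) = D at *
  generalize ((∏ j ∈ Finset.range n, unitPart p (1 - 3 * h - n + j) : ℤ_[p]) : ℚ_[p]) = N at *
  push_cast
  generalize ((-1 : ℚ_[p]) ^ n) = s at *
  have h0 : (h : ℚ_[p]) ≠ 0 := right_ne_zero_of_mul e3
  field_simp
  linear_combination -(padicGamma p (1 + h) : ℚ_[p]) * N *
    (padicGamma p (1 - 3 * h - n) : ℚ_[p]) * hs

end

theorem prod_shift_div_prod_reflect {K : Type*} [Field K] (a : K) (n : ℕ)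
    (h : ∀ j : ℕ, a + j ≠ 0) :
    (∏ j ∈ Finset.range n, (1 + a + (j : K))) / ∏ j ∈ Finset.range n, (1 - a - n + (j : K)) =
      (-1) ^ n * (a + n) / a := by
  have h1 : ∏ j ∈ Finset.range n, (1 - a - n + (j : K)) =
      (-1) ^ n * ∏ j ∈ Finset.range n, (a + j) := by
    have hneg := Finset.prod_neg (s := Finset.range n) (fun j : ℕ => a + (j : K))
    rw [Finset.card_range] at hneg
    rw [← hneg, ← Finset.prod_range_reflect]
    refine Finset.prod_congr rfl fun j hj => ?_
    have hj := Finset.mem_range.mp hj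
    have : ((n - 1 - j : ℕ) : K) + 1 + j = n := by
      exact_mod_cast congrArg (Nat.cast : ℕ → K) (by omega : n - 1 - j + 1 + j = n)
    linear_combination this
  have h2 : a * ∏ j ∈ Finset.range n, (1 + a + (j : K)) =
      (∏ j ∈ Finset.range n, (a + (j : K))) * (a + n) := by
    rw [← Finset.prod_range_succ, Finset.prod_range_succ', mul_comm, Nat.cast_zero, add_zero]
    congr 1
    exact Finset.prod_congr rfl fun j _ => by push_cast; ring
  have h3 : ∏ j ∈ Finset.range n, (a + (j : K)) ≠ 0 := Finset.prod_ne_zero_iff.mpr fun j _ => h j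
  have h0 : a ≠ 0 := by simpa using h 0
  have hs : ((-1 : K) ^ n) * (-1) ^ n = 1 := by
    rw [← pow_add, (Even.add_self n).neg_one_pow]
  have hs0 : ((-1 : K) ^ n) ≠ 0 := left_ne_zero_of_mul_eq_one hs
  rw [h1, div_eq_div_iff (mul_ne_zero hs0 h3) h0]
  linear_combination h2 - (∏ j ∈ Finset.range n, (a + (j : K))) * (a + n) * hs

section
variable {p : ℕ} [Fact p.Prime]

theorem wellPoisedSum_eq_unitQuotient {H n t : ℕ} (hH : 0 < H) (hn : n < p)
    (hh : 2 * H + n = p * t) {u v : ℚ_[p]} (hv : v ≠ 0)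
    (hN : ((∏ j ∈ Finset.range n, (1 - 3 * (H : ℤ_[p]) - n + j) : ℤ_[p]) : ℚ_[p]) =
      u * ((∏ j ∈ Finset.range n, unitPart p (1 - 3 * (H : ℤ_[p]) - n + j) : ℤ_[p]) : ℚ_[p]))
    (hD : ((∏ j ∈ Finset.range n, (1 + (H : ℤ_[p]) + j) : ℤ_[p]) : ℚ_[p]) =
      v * ((∏ j ∈ Finset.range n, unitPart p (1 + (H : ℤ_[p]) + j) : ℤ_[p]) : ℚ_[p])) :
    wellPoisedSum (2 * H : ℚ_[p]) ((p * t) ^ 2) p = p * t * u / v * unitQuotient p H n := by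
  have hh' : (2 * H : ℚ_[p]) + n = p * t := by exact_mod_cast congrArg (Nat.cast : ℕ → ℚ_[p]) hh
  have ha : ∀ j : ℕ, (2 * H : ℚ_[p]) + j ≠ 0 := fun j => by
    exact_mod_cast (by omega : 2 * H + j ≠ 0)
  have hd := wellPoisedSum_eq_prod (2 * H : ℚ_[p]) n hn (fun j hj => by
      have h : (((n - 1 - j : ℕ) : ℚ_[p])) + 1 + j = n := by
        exact_mod_cast (by omega : n - 1 - j + 1 + j = n)
      rw [show 1 - (2 * H : ℚ_[p]) - n + j = -(2 * H + (n - 1 - j : ℕ)) by linear_combination h]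
      exact neg_ne_zero.mpr (ha _))
    (fun j => by exact_mod_cast (by omega : 1 + 2 * H + j ≠ 0))
    (fun j => by
      rw [mul_div_cancel_left₀ _ (two_ne_zero : (2 : ℚ_[p]) ≠ 0)]
      exact_mod_cast (by omega : 1 + H + j ≠ 0))
  rw [hh', mul_div_cancel_left₀ _ (two_ne_zero : (2 : ℚ_[p]) ≠ 0)] at hd
  rw [hd, Finset.prod_div_distrib, Finset.prod_mul_distrib, Finset.prod_mul_distrib]
  have hN' : ∏ j ∈ Finset.range n, (1 - 3 * (H : ℚ_[p]) - n + j) =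
      u * ((∏ j ∈ Finset.range n, unitPart p (1 - 3 * (H : ℤ_[p]) - n + j) : ℤ_[p]) : ℚ_[p]) := by
    rw [← hN, PadicInt.coe_finsetProd]
    exact Finset.prod_congr rfl fun j _ => by push_cast; rfl
  have hD' : ∏ j ∈ Finset.range n, (1 + (H : ℚ_[p]) + j) =
      v * ((∏ j ∈ Finset.range n, unitPart p (1 + (H : ℤ_[p]) + j) : ℤ_[p]) : ℚ_[p]) := by
    rw [← hD, PadicInt.coe_finsetProd]
    exact Finset.prod_congr rfl fun j _ => by push_cast; rfl
  rw [mul_comm (∏ j ∈ Finset.range n, (1 + (H : ℚ_[p]) + j)), mul_div_mul_comm,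
    prod_shift_div_prod_reflect _ n ha, hh', hN', hD', unitQuotient]
  have e2 : ((∏ j ∈ Finset.range n, unitPart p (1 + (H : ℤ_[p]) + j) : ℤ_[p]) : ℚ_[p]) ≠ 0 :=
    norm_ne_zero_iff.mp (by rw [prod_unitPart_norm]; exact one_ne_zero)
  have e3 : (H : ℚ_[p]) ≠ 0 := by exact_mod_cast hH.ne'
  generalize ((∏ j ∈ Finset.range n, unitPart p (1 + (H : ℤ_[p]) + j) : ℤ_[p]) : ℚ_[p]) = D at *
  generalize ((∏ j ∈ Finset.range n, unitPart p (1 - 3 * (H : ℤ_[p]) - n + j) : ℤ_[p]) :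
    ℚ_[p]) = N at *
  push_cast
  field_simp

theorem unitQuotient_mem {H n t : ℕ} (hn0 : 0 < n) (hn : n < p)
    (hh : 2 * H + n = p * t) : unitQuotient p (H : ℤ_[p]) n ∈ padicPow p 0 := by
  have h2 : ‖(2 * ((H : ℤ_[p]) : ℚ_[p]))‖ = 1 := by
    have : ‖((2 * H : ℕ) : ℚ_[p])‖ = 1 := by
      rw [Padic.norm_natCast_eq_one_iff, Nat.Prime.coprime_iff_not_dvd Fact.out]
      intro h
      have : p ∣ n := (Nat.dvd_add_right h).mp (hh ▸ dvd_mul_right p t)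
      exact Nat.not_dvd_of_pos_of_lt hn0 hn this
    simpa using this
  rw [mem_padicPow_zero, unitQuotient, norm_div, norm_mul, norm_div, h2, prod_unitPart_norm,
    prod_unitPart_norm]
  simp

variable {H n t m τ : ℕ}

theorem gammaSecondRatio_args (hm : H + m = p * τ) :
    (1 - H : ℤ_[p]) = 1 + m + p * (-(τ : ℤ_[p])) := by
  have : (H : ℤ_[p]) + m = p * τ := by exact_mod_cast congrArg (Nat.cast : ℕ → ℤ_[p]) hm
  linear_combination -this

theorem two_mul_sub_neg_mem (hh : 2 * H + n = p * t) :
    (2 * H : ℚ_[p]) - -(n : ℚ_[p]) ∈ padicPow p 1 := by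
  have hh' : (2 * H : ℚ_[p]) + n = p * t := by exact_mod_cast congrArg (Nat.cast : ℕ → ℚ_[p]) hh
  rw [sub_neg_eq_add, hh']
  exact mul_mem_padicPow prime_mem_padicPow_one (natCast_mem_padicPow_zero t)

theorem two_mul_natCast_mem (H : ℕ) : (2 * H : ℚ_[p]) ∈ padicPow p 0 := by
  exact_mod_cast natCast_mem_padicPow_zero (p := p) (2 * H)

theorem wellPoisedSum_congr_of_odd (hp : Odd p) (hn : n < p) (hodd : Odd n)
    (hh : 2 * H + n = p * t) (hm : H + m = p * τ) (hmp : m < p)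
    (hR : wellPoisedSum (2 * H : ℚ_[p]) ((p * t) ^ 2) p ∈ padicPow p 1) :
    wellPoisedSum (2 * H : ℚ_[p]) 0 p -
      wellPoisedSum (2 * H : ℚ_[p]) ((p * t) ^ 2) p * gammaSecondRatio p (1 - H) t ∈
        padicPow p 3 := by
  have hq := natCast_prime_mul_sq_mem (p := p) t
  have hne : ∀ q ∈ padicPow p 2, ∀ j < n, ((j : ℚ_[p]) + 1) ^ 2 - q ≠ 0 := fun q hq j hj =>
    norm_ne_zero_iff.mp (by rw [norm_sq_sub_eq_one (by omega) hq]; exact one_ne_zero)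
  have hi := wellPoisedSum_increment (two_mul_natCast_mem H)
    (neg_mem (natCast_mem_padicPow_zero n)) (two_mul_sub_neg_mem hh) hq
  rw [wellPoisedSum_neg_odd _ hodd (hne _ hq) hn,
    wellPoisedSum_neg_odd _ hodd (hne _ (zero_mem _)) hn, sub_zero, sub_zero] at hi
  have hw := gammaSecondRatio_sub_one_mem hp hmp (-(τ : ℤ_[p])) t
  rw [← gammaSecondRatio_args hm] at hw
  have := add_mem hi (mul_mem_padicPow hR hw)
  rw [← neg_mem_iff]
  convert this using 1
  ring

theorem wellPoisedSum_congr_of_even (hp : Odd p) (hn : 2 * m < p)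
    (hh : 2 * H + 2 * m = p * t) (hm : H + m = p * τ)
    (hR : wellPoisedSum (2 * H : ℚ_[p]) ((p * t) ^ 2) p ∈ padicPow p 0)
    (hcase : 5 ≤ p ∨ wellPoisedSum (2 * H : ℚ_[p]) ((p * t) ^ 2) p ∈ padicPow p 1) :
    wellPoisedSum (2 * H : ℚ_[p]) 0 p -
      wellPoisedSum (2 * H : ℚ_[p]) ((p * t) ^ 2) p * gammaSecondRatio p (1 - H) t ∈
        padicPow p 3 := by
  have hq := natCast_prime_mul_sq_mem (p := p) t
  have hne : ∀ q ∈ padicPow p 2, ∀ j < 2 * m, ((j : ℚ_[p]) + 1) ^ 2 - q ≠ 0 := fun q hq j hj =>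
    norm_ne_zero_iff.mp (by rw [norm_sq_sub_eq_one (by omega) hq]; exact one_ne_zero)
  have hprod : ∀ q ∈ padicPow p 2, ∏ j ∈ Finset.range m, (((j : ℚ_[p]) + 1) ^ 2 - q) ≠ 0 :=
    fun q hq => Finset.prod_ne_zero_iff.mpr fun j hj =>
      hne q hq j (by have := Finset.mem_range.mp hj; omega)
  have hi := wellPoisedSum_increment (two_mul_natCast_mem H)
    (neg_mem (natCast_mem_padicPow_zero (2 * m))) (two_mul_sub_neg_mem hh) hq
  have hs := wellPoisedSum_sub_mem (two_mul_natCast_mem H)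
    (neg_mem (natCast_mem_padicPow_zero (2 * m))) (two_mul_sub_neg_mem hh) hq
  have hmp : m < p := by omega
  have hw := gammaSecondRatio_sub_one_mem hp hmp (-(τ : ℤ_[p])) t
  rw [← gammaSecondRatio_args hm] at hw
  have hf := (incrementCongr_gammaSecondRatio hmp 0 t).right_incr
  set F : ℚ_[p] := ∏ j ∈ Finset.range m, (((j : ℚ_[p]) + 1) ^ 2 - ((p : ℚ_[p]) * t) ^ 2) /
    ((j : ℚ_[p]) + 1) ^ 2 with hF
  have hrel : wellPoisedSum (-((2 * m : ℕ) : ℚ_[p])) 0 p =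
      wellPoisedSum (-((2 * m : ℕ) : ℚ_[p])) ((p * t) ^ 2) p * F := by
    rw [wellPoisedSum_neg_even _ m (hne _ hq) hn, wellPoisedSum_neg_even _ m (hne _ (zero_mem _)) hn,
      hF, Finset.prod_div_distrib]
    have h1 := hprod _ hq
    have h2 := hprod _ (zero_mem _)
    simp only [sub_zero] at h2 ⊢
    rw [div_mul_div_comm, div_eq_div_iff h2 (mul_ne_zero h1 h2)]
    ring
  rw [hrel] at hi
  generalize wellPoisedSum (2 * H : ℚ_[p]) ((p * t) ^ 2) p = R at *
  generalize wellPoisedSum (2 * H : ℚ_[p]) 0 p = S at *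
  generalize wellPoisedSum (-((2 * m : ℕ) : ℚ_[p])) ((p * t) ^ 2) p = Q at *
  rw [← neg_mem_iff]
  rcases hcase with h5 | hR1
  · have hw3 := gammaSecondRatio_sub_prod_mem hp h5 hmp (-(τ : ℤ_[p])) t
    rw [← gammaSecondRatio_args hm, ← hF] at hw3
    have hQ : Q ∈ padicPow p 0 := by
      have := sub_mem hR (padicPow_mono (Nat.zero_le 1) hs)
      rwa [sub_sub_cancel] at this
    have := add_mem hi (add_mem (mul_mem_padicPow hs hw) (mul_mem_padicPow_right hQ hw3))
    convert this using 1
    ring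
  · have hQ : Q ∈ padicPow p 1 := by
      have := sub_mem hR1 hs
      rwa [sub_sub_cancel] at this
    have := add_mem hi (sub_mem (mul_mem_padicPow hR1 hw) (mul_mem_padicPow hQ hf))
    convert this using 1
    ring

end

section
variable {p : ℕ} [Fact p.Prime] {H n t m τ : ℕ}

theorem two_mem_padicPow_zero : (2 : ℚ_[p]) ∈ padicPow p 0 := by
  exact_mod_cast natCast_mem_padicPow_zero (p := p) 2

theorem prime_sub_three_mul_mem (hm : H + m = p * τ) (c : ℕ) :
    (c * p : ℚ_[p]) - 3 * (H + m) ∈ padicPow p 1 := by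
  have hm' : (H : ℚ_[p]) + m = p * τ := by exact_mod_cast congrArg (Nat.cast : ℕ → ℚ_[p]) hm
  rw [hm', show (c * p : ℚ_[p]) - 3 * (p * τ) = p * (c : ℚ_[p]) - p * ((3 * τ : ℕ) : ℚ_[p]) by
    push_cast; ring]
  exact sub_mem (mul_mem_padicPow prime_mem_padicPow_one (natCast_mem_padicPow_zero c))
    (mul_mem_padicPow prime_mem_padicPow_one (natCast_mem_padicPow_zero _))

theorem dvd_mul_prime_sub_three_mul (hm : H + m = p * τ) (c : ℕ) :
    (p : ℤ_[p]) ∣ c * p - 3 * (H + m) := by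
  have hm' : (H : ℤ_[p]) + m = p * τ := by exact_mod_cast congrArg (Nat.cast : ℕ → ℤ_[p]) hm
  rw [hm']
  exact ⟨c - 3 * τ, by ring⟩

theorem truncated_dixon_even (hp : Odd p) (hH : 0 < H) (hm0 : 0 < m) (hn : 2 * m < p)
    (hh : 2 * H + 2 * m = p * t) (hm : H + m = p * τ) (hcase : 5 ≤ p ∨ p ≤ 3 * m) :
    wellPoisedSum (2 * H : ℚ_[p]) 0 p -
      2 * (if p ≤ 3 * m then (p : ℚ_[p]) - 3 * (H + m) else 1) * dixonG p (2 * H) ∈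
        padicPow p 3 := by
  have hx : (1 - 3 * (H : ℤ_[p]) - (2 * m : ℕ)) + ((p - 1 - m : ℕ) : ℤ_[p]) =
      (1 : ℕ) * p - 3 * (H + m) := by
    have h : ((p - 1 - m : ℕ) : ℤ_[p]) + 1 + m = p := by
      exact_mod_cast (by omega : p - 1 - m + 1 + m = p)
    push_cast
    linear_combination h
  have hx' : (1 + (H : ℤ_[p])) + ((m - 1 : ℕ) : ℤ_[p]) = H + m := by
    have h : ((m - 1 : ℕ) : ℤ_[p]) + 1 = m := by
      exact_mod_cast (by omega : m - 1 + 1 = m)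
    linear_combination h
  have hN := prod_add_eq_mul_prod_unitPart (x := 1 - 3 * (H : ℤ_[p]) - ((2 * m : ℕ) : ℤ_[p]))
    (i := p - 1 - m) (n := 2 * m) (by omega) hn.le
    (by rw [hx]; exact dvd_mul_prime_sub_three_mul hm 1)
  have hD := prod_add_eq_mul_prod_unitPart (x := 1 + (H : ℤ_[p]))
    (i := m - 1) (n := 2 * m) (by omega) hn.le
    (by rw [hx']; exact ⟨τ, by exact_mod_cast congrArg (Nat.cast : ℕ → ℤ_[p]) hm⟩)
  rw [hx, if_congr (by omega : p - 1 - m < 2 * m ↔ p ≤ 3 * m) rfl rfl] at hN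
  rw [hx', if_pos (by omega)] at hD
  have hN' := congrArg (fun x : ℤ_[p] => (x : ℚ_[p])) hN
  have hD' := congrArg (fun x : ℤ_[p] => (x : ℚ_[p])) hD
  simp only [PadicInt.coe_mul] at hN' hD'
  have hv : (((H : ℤ_[p]) + m : ℤ_[p]) : ℚ_[p]) = H + m := by push_cast; rfl
  have hv0 : (((H : ℤ_[p]) + m : ℤ_[p]) : ℚ_[p]) ≠ 0 := by
    rw [hv]; exact_mod_cast (by omega : H + m ≠ 0)
  have hR := wellPoisedSum_eq_unitQuotient hH hn hh hv0 hN' hD'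
  set u : ℚ_[p] := if p ≤ 3 * m then (p : ℚ_[p]) - 3 * (H + m) else 1 with hu
  have hu' : ((if p ≤ 3 * m then ((1 : ℕ) : ℤ_[p]) * p - 3 * (H + m) else 1 : ℤ_[p]) : ℚ_[p]) =
      u := by
    have c2 : ((2 : ℤ_[p]) : ℚ_[p]) = 2 := rfl
    have c3 : ((3 : ℤ_[p]) : ℚ_[p]) = 3 := rfl
    rw [hu]; split_ifs <;> push_cast [c2, c3] <;> ring
  have hpt : (p : ℚ_[p]) * t = 2 * (H + m) := by
    have : (2 * H : ℚ_[p]) + 2 * m = p * t := by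
      exact_mod_cast congrArg (Nat.cast : ℕ → ℚ_[p]) hh
    linear_combination -this
  have hR2 : wellPoisedSum (2 * H : ℚ_[p]) ((p * t) ^ 2) p =
      2 * u * unitQuotient p H (2 * m) := by
    rw [hR, hu', hv]
    rw [hv] at hv0
    congr 1
    rw [hpt]
    field_simp
  have hq := unitQuotient_mem (by omega) hn hh
  have hu1 : p ≤ 3 * m → u ∈ padicPow p 1 := fun h => by
    rw [hu, if_pos h]; simpa using prime_sub_three_mul_mem hm 1
  have hu0 : u ∈ padicPow p 0 := by
    by_cases h : p ≤ 3 * m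
    · exact padicPow_mono (Nat.zero_le 1) (hu1 h)
    · rw [hu, if_neg h]; exact one_mem_padicPow_zero
  have hmain := wellPoisedSum_congr_of_even hp hn hh hm
    (by rw [hR2]; exact mul_mem_padicPow (mul_mem_padicPow two_mem_padicPow_zero hu0) hq)
    (hcase.imp_right fun h => by
      rw [hR2]
      exact mul_mem_padicPow_left (mul_mem_padicPow_right two_mem_padicPow_zero (hu1 h)) hq)
  have hg := dixonG_eq_mul hp (n := 2 * m) (t := t) (h := (H : ℤ_[p])) (by omega) hn
    (by exact_mod_cast congrArg (Nat.cast : ℕ → ℤ_[p]) hh)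
  rw [hR2] at hmain
  rw [hg]
  convert hmain using 2
  ring

theorem truncated_dixon_odd (hp : Odd p) (hH : 0 < H) (hn : n < p) (hodd : Odd n)
    (hh : 2 * H + n = p * t) (hmn : 2 * m = n + p) (hm : H + m = p * τ) :
    wellPoisedSum (2 * H : ℚ_[p]) 0 p -
      p * t * (if p ≤ 3 * n then (2 * p : ℚ_[p]) - 3 * (H + m) else 1) * dixonG p (2 * H) ∈
        padicPow p 3 := by
  obtain ⟨a, ha⟩ := hodd
  obtain ⟨b, hb⟩ := hp
  have hp : Odd p := ⟨b, hb⟩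
  have hodd : Odd n := ⟨a, ha⟩
  have hx : (1 - 3 * (H : ℤ_[p]) - n) + ((p - 1 - m : ℕ) : ℤ_[p]) =
      (2 : ℕ) * p - 3 * (H + m) := by
    have h : ((p - 1 - m : ℕ) : ℤ_[p]) + 1 + m = p := by
      exact_mod_cast (by omega : p - 1 - m + 1 + m = p)
    have h' : (2 * m : ℤ_[p]) = n + p := by exact_mod_cast congrArg (Nat.cast : ℕ → ℤ_[p]) hmn
    push_cast
    linear_combination h + h'
  have hx' : (1 + (H : ℤ_[p])) + ((m - 1 : ℕ) : ℤ_[p]) = H + m := by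
    have h : ((m - 1 : ℕ) : ℤ_[p]) + 1 = m := by
      exact_mod_cast (by omega : m - 1 + 1 = m)
    linear_combination h
  have hN := prod_add_eq_mul_prod_unitPart (x := 1 - 3 * (H : ℤ_[p]) - (n : ℤ_[p]))
    (i := p - 1 - m) (n := n) (by omega) hn.le
    (by rw [hx]; exact dvd_mul_prime_sub_three_mul hm 2)
  have hD := prod_add_eq_mul_prod_unitPart (x := 1 + (H : ℤ_[p]))
    (i := m - 1) (n := n) (by omega) hn.le
    (by rw [hx']; exact ⟨τ, by exact_mod_cast congrArg (Nat.cast : ℕ → ℤ_[p]) hm⟩)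
  rw [hx, if_congr (by omega : p - 1 - m < n ↔ p ≤ 3 * n) rfl rfl] at hN
  rw [hx', if_neg (by omega)] at hD
  have hN' := congrArg (fun x : ℤ_[p] => (x : ℚ_[p])) hN
  have hD' := congrArg (fun x : ℤ_[p] => (x : ℚ_[p])) hD
  simp only [PadicInt.coe_mul] at hN' hD'
  have hR := wellPoisedSum_eq_unitQuotient hH hn hh (by simp) hN' hD'
  set u : ℚ_[p] := if p ≤ 3 * n then (2 * p : ℚ_[p]) - 3 * (H + m) else 1 with hu
  have hu' : ((if p ≤ 3 * n then ((2 : ℕ) : ℤ_[p]) * p - 3 * (H + m) else 1 : ℤ_[p]) : ℚ_[p]) =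
      u := by
    have c2 : ((2 : ℤ_[p]) : ℚ_[p]) = 2 := rfl
    have c3 : ((3 : ℤ_[p]) : ℚ_[p]) = 3 := rfl
    rw [hu]; split_ifs <;> push_cast [c2, c3] <;> ring
  rw [hu', PadicInt.coe_one, div_one] at hR
  have hq := unitQuotient_mem (by omega) hn hh
  have hu0 : u ∈ padicPow p 0 := by
    rw [hu]
    split_ifs
    · exact padicPow_mono (Nat.zero_le 1) (by simpa using prime_sub_three_mul_mem hm 2)
    · exact one_mem_padicPow_zero
  have hmain := wellPoisedSum_congr_of_odd hp hn hodd hh hm (by omega) (by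
    rw [hR]
    exact mul_mem_padicPow_left (mul_mem_padicPow_left (mul_mem_padicPow prime_mem_padicPow_one
      (natCast_mem_padicPow_zero t)) hu0) hq)
  have hg := dixonG_eq_mul hp (n := n) (t := t) (h := (H : ℤ_[p])) (by omega) hn
    (by exact_mod_cast congrArg (Nat.cast : ℕ → ℤ_[p]) hh)
  rw [hR] at hmain
  rw [hg]
  convert hmain using 2
  ring

theorem prod_sub_prod_mem {r : ℕ} {f g : ℕ → ℚ_[p]} (k : ℕ) (hf : ∀ j < k, f j ∈ padicPow p 0)
    (hg : ∀ j < k, g j ∈ padicPow p 0) (h : ∀ j < k, f j - g j ∈ padicPow p r) :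
    (∏ j ∈ Finset.range k, f j) ∈ padicPow p 0 ∧
      ∏ j ∈ Finset.range k, f j - ∏ j ∈ Finset.range k, g j ∈ padicPow p r := by
  induction k with
  | zero => simp [one_mem_padicPow_zero, zero_mem]
  | succ k ih =>
    obtain ⟨h1, h2⟩ := ih (fun j hj => hf j (by omega)) (fun j hj => hg j (by omega))
      (fun j hj => h j (by omega))
    simp only [Finset.prod_range_succ]
    exact ⟨mul_mem_padicPow h1 (hf k (by omega)),
      mul_sub_mul_mem h1 (hg k (by omega)) h2 (h k (by omega))⟩

theorem wellPoisedSum_zero_congr {r : ℕ} {a b : ℚ_[p]} (ha : a ∈ padicPow p 0)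
    (hb : b ∈ padicPow p 0) (hab : a - b ∈ padicPow p r) :
    wellPoisedSum a 0 p - wellPoisedSum b 0 p ∈ padicPow p r := by
  rw [wellPoisedSum, wellPoisedSum, ← Finset.sum_sub_distrib]
  refine sum_mem fun k hk => ?_
  have hk := Finset.mem_range.mp hk
  have ha' := fun j : ℕ => add_mem ha (natCast_mem_padicPow_zero (p := p) j)
  have hb' := fun j : ℕ => add_mem hb (natCast_mem_padicPow_zero (p := p) j)
  have hab' : ∀ j : ℕ, a + j - (b + j) ∈ padicPow p r := fun j => by
    rwa [add_sub_add_right_eq_sub]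
  have hcube : ∀ {x : ℚ_[p]}, x ∈ padicPow p 0 → x * (x ^ 2 - 0) ∈ padicPow p 0 := fun hx => by
    rw [sub_zero]; exact mul_mem_padicPow hx (sq_mem_padicPow_zero hx)
  have hinv : ∀ j < k, (((j : ℚ_[p]) + 1) * (((j : ℚ_[p]) + 1) ^ 2 - 0))⁻¹ ∈ padicPow p 0 :=
    fun j hj => (IncrementCongr.denominator (by omega) (zero_mem _)).left_mem
  refine (prod_sub_prod_mem k (fun j hj => ?_) (fun j hj => ?_) (fun j hj => ?_)).2
  · exact mul_mem_padicPow (hcube (ha' j)) (hinv j hj)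
  · exact mul_mem_padicPow (hcube (hb' j)) (hinv j hj)
  · rw [div_eq_mul_inv, div_eq_mul_inv, ← sub_mul]
    refine mul_mem_padicPow_left ?_ (hinv j hj)
    rw [sub_zero, sub_zero]
    exact mul_sub_mul_mem (ha' j) (sq_mem_padicPow_zero (hb' j)) (hab' j)
      (sq_sub_sq_mem (ha' j) (hb' j) (hab' j))

theorem coe_padicGamma_congr (hp : Odd p) {r : ℕ} {x y : ℤ_[p]} (h : (p : ℤ_[p]) ^ r ∣ x - y) :
    (padicGamma p x : ℚ_[p]) - (padicGamma p y : ℚ_[p]) ∈ padicPow p r := by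
  rw [← PadicInt.coe_sub]
  exact coe_mem_padicPow_iff.mpr (padicGamma_congr hp r h)

theorem dixonG_mem (hp : Odd p) (α : ℤ_[p]) : dixonG p α ∈ padicPow p 0 := by
  rw [mem_padicPow_zero, dixonG]
  simp [norm_div, norm_mul, padicGamma_norm hp]

theorem dixonG_congr (hp : Odd p) {r : ℕ} {x y : ℤ_[p]} (h : (p : ℤ_[p]) ^ r ∣ x - y) :
    dixonG p (2 * x) - dixonG p (2 * y) ∈ padicPow p r := by
  rw [dixonG_two_mul hp, dixonG_two_mul hp, div_eq_mul_inv, div_eq_mul_inv]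
  have hint : ∀ z : ℤ_[p], (padicGamma p z : ℚ_[p]) ∈ padicPow p 0 := fun z =>
    coe_mem_padicPow_zero _
  have hlin : ∀ c : ℤ_[p], (padicGamma p (1 + c * x) : ℚ_[p]) - padicGamma p (1 + c * y) ∈
      padicPow p r := fun c => coe_padicGamma_congr hp (by
    rw [add_sub_add_left_eq_sub, ← mul_sub]; exact dvd_mul_of_dvd_right h c)
  have h1 := hlin 1
  have h2 := hlin (-3)
  have h3 := hlin 2
  have h4 := hlin (-2)
  have h5 := hlin (-1)
  simp only [one_mul, neg_mul, ← sub_eq_add_neg] at h1 h2 h3 h4 h5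
  have hnorm : ∀ z : ℤ_[p], ‖(padicGamma p (1 + 2 * z) : ℚ_[p]) * padicGamma p (1 - 2 * z) *
      (padicGamma p (1 - z) : ℚ_[p]) ^ 2‖ = 1 := fun z => by
    simp [norm_mul, padicGamma_norm hp]
  refine mul_sub_mul_mem (mul_mem_padicPow (hint _) (hint _)) (inv_mem_padicPow_zero (hnorm y))
    (mul_sub_mul_mem (hint _) (hint _) h1 h2) (inv_sub_inv_mem (hnorm x) (hnorm y) ?_)
  exact mul_sub_mul_mem (mul_mem_padicPow (hint _) (hint _)) (sq_mem_padicPow_zero (hint _))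
    (mul_sub_mul_mem (hint _) (hint _) h3 h4) (sq_sub_sq_mem (hint _) (hint _) h5)

end

section
variable {p : ℕ} [Fact p.Prime]

theorem dvd_add_leastResidue_neg (α : ℤ_[p]) : (p : ℤ_[p]) ∣ α + leastResidue p (-α) := by
  rw [← PadicInt.toZMod_eq_zero_iff_dvd, leastResidue]
  simp

theorem leastResidue_lt (α : ℤ_[p]) : leastResidue p α < p := ZMod.val_lt _

theorem leastResidue_neg_pos {α : ℤ_[p]} (hα : IsUnit α) : 0 < leastResidue p (-α) := by
  rw [Nat.pos_iff_ne_zero]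
  intro h
  have := dvd_add_leastResidue_neg α
  rw [h, Nat.cast_zero, add_zero] at this
  exact PadicInt.isUnit_iff_not_dvd.mp hα this

theorem exists_even_natCast_congr (hp : Odd p) (α : ℤ_[p]) :
    ∃ H t : ℕ, 0 < H ∧ 2 * H + leastResidue p (-α) = p * t ∧
      (p : ℤ_[p]) ^ 3 ∣ padicHalf p * α - H := by
  obtain ⟨N, hN⟩ := PadicInt.exists_natCast_congr 3 (padicHalf p * α)
  have hd : (p : ℤ_[p]) ^ 3 ∣ padicHalf p * α - ((N + p ^ 3 : ℕ) : ℤ_[p]) := by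
    push_cast
    rw [← sub_sub]
    exact dvd_sub hN dvd_rfl
  have hdiv : p ∣ 2 * (N + p ^ 3) + leastResidue p (-α) := by
    rw [← PadicInt.natCast_dvd_natCast]
    have h1 := dvd_add_leastResidue_neg α
    have h2 := dvd_mul_of_dvd_right ((dvd_pow_self (p : ℤ_[p]) three_ne_zero).trans hd) 2
    have := dvd_sub h1 h2
    convert this using 1
    push_cast
    linear_combination α * two_mul_padicHalf hp
  obtain ⟨t, ht⟩ := hdiv
  exact ⟨N + p ^ 3, t, Nat.add_pos_right _ (pow_pos (Fact.out : p.Prime).pos 3), ht, hd⟩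

theorem natCast_two_mul_sub_mem (hp : Odd p) {α : ℤ_[p]} {H : ℕ}
    (h : (p : ℤ_[p]) ^ 3 ∣ padicHalf p * α - H) :
    (α : ℚ_[p]) - 2 * H ∈ padicPow p 3 := by
  have h2 : (p : ℤ_[p]) ^ 3 ∣ α - 2 * H := by
    have := dvd_mul_of_dvd_right h 2
    convert this using 1
    linear_combination -α * two_mul_padicHalf hp
  have h3 := coe_mem_padicPow_iff.mpr h2
  push_cast at h3
  exact h3

theorem padicCongr_of_even_natCast (hp : Odd p) {α : ℤ_[p]} {H : ℕ}
    (h : (p : ℤ_[p]) ^ 3 ∣ padicHalf p * α - H) {c c' : ℚ_[p]} (hc : c ∈ padicPow p 0)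
    (hcc : c - c' ∈ padicPow p 3)
    (hS : wellPoisedSum (2 * H : ℚ_[p]) 0 p - c' * dixonG p (2 * H) ∈ padicPow p 3) :
    PadicCongr p 3
      (truncHypergeom [(α : ℚ_[p]), (α : ℚ_[p]), (α : ℚ_[p])] [1, 1] 1 (p - 1))
      (c * dixonG p α) := by
  rw [padicCongr_iff, truncHypergeom_eq_wellPoisedSum]
  have h1 := wellPoisedSum_zero_congr (coe_mem_padicPow_zero α) (two_mul_natCast_mem H)
    (natCast_two_mul_sub_mem hp h)
  have h2 := dixonG_congr hp h
  rw [← mul_assoc, two_mul_padicHalf hp, one_mul] at h2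
  have h3 := mul_sub_mul_mem hc (dixonG_mem hp (2 * (H : ℤ_[p]))) hcc h2
  have := sub_mem (add_mem h1 hS) h3
  convert this using 1
  ring

theorem prime_mul_padicDash (α : ℤ_[p]) :
    (p : ℚ_[p]) * padicDash p α = α + leastResidue p (-α) := by
  have : (p : ℚ_[p]) ≠ 0 := by exact_mod_cast (Fact.out : p.Prime).ne_zero
  rw [padicDash, mul_div_cancel₀ _ this]

theorem dvd_of_two_mul_eq {p : ℕ} (hp : Odd p) {k t : ℕ} (h : 2 * k = p * t) : ∃ τ, k = p * τ := by
  have hc : Nat.Coprime p 2 := (Nat.coprime_two_right).mpr hp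
  exact hc.dvd_of_dvd_mul_left (h ▸ dvd_mul_right p t)

theorem one_half_mem_padicPow_zero (hp : Odd p) : (1 / 2 : ℚ_[p]) ∈ padicPow p 0 := by
  have h := congrArg (fun x : ℤ_[p] => (x : ℚ_[p])) (two_mul_padicHalf hp)
  have h2 : (1 / 2 : ℚ_[p]) = (padicHalf p : ℚ_[p]) := by
    have : (2 : ℚ_[p]) * (padicHalf p : ℚ_[p]) = 1 := by
      have e : ((2 : ℤ_[p]) : ℚ_[p]) = 2 := by norm_cast
      rw [← e, ← PadicInt.coe_mul]
      simpa using h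
    rw [div_eq_iff two_ne_zero, mul_comm, this]
  rw [h2]
  exact coe_mem_padicPow_zero _

end

theorem theorem5p1 (p : ℕ) [Fact p.Prime] (hp : Odd p) (α : ℤ_[p]) (hα : IsUnit α) :
    (Even (leastResidue p (-α)) ∧ (leastResidue p (-α) : ℚ) < 2 / 3 * p →
      PadicCongr p 3
        (truncHypergeom [(α : ℚ_[p]), (α : ℚ_[p]), (α : ℚ_[p])] [1, 1] 1 (p - 1))
        (2 * dixonG p α)) ∧
    (Even (leastResidue p (-α)) ∧ 2 / 3 * p ≤ (leastResidue p (-α) : ℚ) →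
      PadicCongr p 3
        (truncHypergeom [(α : ℚ_[p]), (α : ℚ_[p]), (α : ℚ_[p])] [1, 1] 1 (p - 1))
        (p * (2 - 3 * padicDash p α) * dixonG p α)) ∧
    (Odd (leastResidue p (-α)) ∧ (leastResidue p (-α) : ℚ) < 1 / 3 * p →
      PadicCongr p 3
        (truncHypergeom [(α : ℚ_[p]), (α : ℚ_[p]), (α : ℚ_[p])] [1, 1] 1 (p - 1))
        (p * padicDash p α * dixonG p α)) ∧
    (Odd (leastResidue p (-α)) ∧ 1 / 3 * p ≤ (leastResidue p (-α) : ℚ) →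
      PadicCongr p 3
        (truncHypergeom [(α : ℚ_[p]), (α : ℚ_[p]), (α : ℚ_[p])] [1, 1] 1 (p - 1))
        (1 / 2 * p ^ 2 * padicDash p α * (1 - 3 * padicDash p α) * dixonG p α)) := by
  obtain ⟨H, t, hH, hh, hcong⟩ := exists_even_natCast_congr hp α
  have hn0 := leastResidue_neg_pos hα
  have hn := leastResidue_lt (-α)
  have hdash := prime_mul_padicDash α
  generalize leastResidue p (-α) = n at *
  have hd3 := natCast_two_mul_sub_mem hp hcong
  have hh' : (2 * H : ℚ_[p]) + n = p * t := by exact_mod_cast congrArg (Nat.cast : ℕ → ℚ_[p]) hh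
  have hαn : (α : ℚ_[p]) + n - p * t ∈ padicPow p 3 := by
    rw [← hh', add_sub_add_right_eq_sub]; exact hd3
  have hα0 : (α : ℚ_[p]) + n ∈ padicPow p 0 :=
    add_mem (coe_mem_padicPow_zero α) (natCast_mem_padicPow_zero n)
  have hp0 : (p : ℚ_[p]) ∈ padicPow p 0 := natCast_mem_padicPow_zero p
  have h30 : (3 : ℚ_[p]) ∈ padicPow p 0 := by exact_mod_cast natCast_mem_padicPow_zero (p := p) 3
  have hpt0 : (p : ℚ_[p]) * t ∈ padicPow p 0 := mul_mem_padicPow hp0 (natCast_mem_padicPow_zero t)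
  refine ⟨?_, ?_, ?_, ?_⟩
  · rintro ⟨⟨m, hm⟩, hlt⟩
    obtain rfl : n = 2 * m := by omega
    have hlt' : 3 * m < p := by
      have : (3 * m : ℚ) < p := by push_cast at hlt; linarith
      exact_mod_cast this
    obtain ⟨τ, hτ⟩ := dvd_of_two_mul_eq hp (k := H + m) (t := t) (by omega)
    have h5 : 5 ≤ p := by obtain ⟨b, hb⟩ := hp; omega
    have := truncated_dixon_even hp hH (by omega) hn hh hτ (Or.inl h5)
    rw [if_neg (by omega), mul_one] at this
    exact padicCongr_of_even_natCast hp hcong two_mem_padicPow_zero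
      (by rw [sub_self]; exact zero_mem _) this
  · rintro ⟨⟨m, hm⟩, hle⟩
    obtain rfl : n = 2 * m := by omega
    have hle' : p ≤ 3 * m := by
      have : (p : ℚ) ≤ 3 * m := by push_cast at hle; linarith
      exact_mod_cast this
    obtain ⟨τ, hτ⟩ := dvd_of_two_mul_eq hp (k := H + m) (t := t) (by omega)
    have := truncated_dixon_even hp hH (by omega) hn hh hτ (Or.inr hle')
    rw [if_pos hle'] at this
    have e : (p : ℚ_[p]) * (2 - 3 * padicDash p α) = 2 * p - 3 * (α + (2 * m : ℕ)) := by
      linear_combination -3 * hdash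
    refine padicCongr_of_even_natCast hp hcong ?_ ?_ this
    · rw [e]
      exact sub_mem (mul_mem_padicPow two_mem_padicPow_zero hp0) (mul_mem_padicPow h30 hα0)
    · rw [e]
      convert neg_mem (mul_mem_padicPow_right h30 hd3) using 1
      push_cast
      ring
  · rintro ⟨hodd, hlt⟩
    have hlt' : 3 * n < p := by
      have : (3 * n : ℚ) < p := by linarith
      exact_mod_cast this
    obtain ⟨m, hm⟩ := hodd.add_odd hp
    obtain ⟨τ, hτ⟩ := dvd_of_two_mul_eq hp (k := H + m) (t := t + 1) (by linarith)
    have := truncated_dixon_odd hp hH hn hodd hh (m := m) (by omega) hτ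
    rw [if_neg (by omega), mul_one] at this
    rw [hdash]
    exact padicCongr_of_even_natCast hp hcong hα0 hαn this
  · rintro ⟨hodd, hle⟩
    have hle' : p ≤ 3 * n := by
      have : (p : ℚ) ≤ 3 * n := by linarith
      exact_mod_cast this
    obtain ⟨m, hm⟩ := hodd.add_odd hp
    obtain ⟨τ, hτ⟩ := dvd_of_two_mul_eq hp (k := H + m) (t := t + 1) (by linarith)
    have := truncated_dixon_odd hp hH hn hodd hh (m := m) (by omega) hτ
    rw [if_pos hle'] at this
    have hm' : (n : ℚ_[p]) + p = m + m := by
      exact_mod_cast congrArg (Nat.cast : ℕ → ℚ_[p]) hm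
    have e : 1 / 2 * (p : ℚ_[p]) ^ 2 * padicDash p α * (1 - 3 * padicDash p α) =
        1 / 2 * (α + n) * (p - 3 * (α + n)) := by
      rw [← hdash]; ring
    have e' : (p : ℚ_[p]) * t * (2 * p - 3 * (H + m)) = 1 / 2 * (p * t) * (p - 3 * (p * t)) := by
      linear_combination (3 / 2) * (p : ℚ_[p]) * t * (hm' - hh')
    have h12 := one_half_mem_padicPow_zero hp
    have hlin : ∀ x ∈ padicPow p 0, (p : ℚ_[p]) - 3 * x ∈ padicPow p 0 := fun x hx =>
      sub_mem hp0 (mul_mem_padicPow h30 hx)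
    rw [e'] at this
    rw [e]
    refine padicCongr_of_even_natCast hp hcong
      (mul_mem_padicPow (mul_mem_padicPow h12 hα0) (hlin _ hα0)) ?_ this
    refine mul_sub_mul_mem (mul_mem_padicPow h12 hα0) (hlin _ hpt0) ?_ ?_
    · rw [← mul_sub]; exact mul_mem_padicPow_right h12 hαn
    · convert neg_mem (mul_mem_padicPow_right h30 hαn) using 1
      ring
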